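/- **Setting.** Let $D_1,\dots,D_n$ ($n\ge 1$) be probability distributions on a space $\mathcal Z$, and let $\Theta$ be a nonempty convex compact subset of a finite-dimensional real normed space $(E,\|\cdot\|_*)$ with $\|\theta-\theta'\|_*\le R$ for all $\theta,\theta'\in\Theta$. Let $\mathcal H=\{h_\theta\}_{\theta\in\Theta}$ be a hypothesis class, and let $\ell_1,\dots,\ell_m:\mathcal H\times\mathcal Z\to[0,1]$ ($m\ge1$) be losses such that for all $j,z$ the map $\theta\mapsto \ell_j(h_\theta,z)$ is convex and differentiable on $\Theta$ with gradient $\nabla\ell_j(h_\theta,z)\in E^*$ of dual norm $\|\nabla \ell_j(h_\theta,z)\|\le 1$ (losses are measurable in $z$, gradients jointly in $(\theta,z)$; where $\Theta$ has empty interior, fix any such choice of the gradient). Put $\mathcal R_{i,j}(h)=\mathbb E_{z\sim D_i}\ell_j(h,z)$ and $\mathrm{OPT}=\min_{h\in\mathcal H}\max_{i,j}\mathcal R_{i,j}(h)$. A hypothesis $h$ is $\epsilon$-optimal if $\max_{i,j}\mathcal R_{i,j}(h)\le \mathrm{OPT}+\epsilon$. The distributions are accessed only through example oracles: each call to $\mathrm{EX}(D_i)$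 returns a fresh independent sample of $D_i$. **Learner.** Let $\mathcal Q_\Theta$ be any (measurable) online learning algorithm, i.e. a map from finite sequences of linear costs $c^{(1)},\dots,c^{(t-1)}\in E^*$ to an action $\theta^{(t)}\in\Theta$. Let $\gamma_T(\mathcal Q_\Theta)\ge0$ be a regret guarantee: for all linear costs with $\|c^{(t)}\|\le1$, $t\le T$, one has $\sum_{t\le T} c^{(t)}(\theta^{(t)})-\min_{\theta\in\Theta}\sum_{t\le T}c^{(t)}(\theta)\le\sqrt{\gamma_T(\mathcal Q_\Theta)\,T}$. **Auditor (high-probability ELP on the partition $\{\{i\}\times[m]\}_{i\in[n]}$ of $[n]\times[m]$).** Let $T\ge1$, $\delta\in(0,1)$, $\eta=\sqrt{\log(mn/\delta)/(nT)}$, $\lambda=\eta/2$, and let the exploration rate be any $\rho\in[0,\min(1/2,\,n\eta)]$. Let $s$ be any distribution on $[n]\times[m]$ that maximizes $\min_i\sum_j s_{ij}$ (the linear program of ELP). Starting from $L^{(1)}=0$, ELP plays $$w^{(t)}_{ij}=(1-\rho)\frac{e^{-\eta L^{(t)}_{ij}}}{\sum_{i',j'}e^{-\eta L^{(t)}_{i'j'}}}+\rho\,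 s_{ij},$$ draws a meta-action from $w^{(t)}$, and observes the costs $c^{(t)}_{i1},\dots,c^{(t)}_{im}$ of all meta-actions in its group $I^{(t)}=\{i\}\times[m]$; then $L^{(t+1)}_{ij}=L^{(t)}_{ij}+c^{(t)}_{ij}/\big(\sum_{j'}w^{(t)}_{ij'}+\lambda\big)$ for $(i,j)\in I^{(t)}$, and $L^{(t+1)}_{ij}=L^{(t)}_{ij}$ otherwise. **Algorithm.** Start with $\theta^{(1)}=\mathcal Q_\Theta(\emptyset)$ and $w^{(1)}$. For $t=2,\dots,T$: draw $(i,j)\sim w^{(t-1)}$ and one datapoint $z\sim\mathrm{EX}(D_i)$, and give the learner the linear cost $c^{(t-1)}=\nabla\ell_j(h_{\theta^{(t-1)}},z)$, so that $\theta^{(t)}=\mathcal Q_\Theta(c^{(1)},\dots,c^{(t-1)})$; independently, draw the auditor's group $\{i'\}\times[m]$ according to $w^{(t-1)}$ and one datapoint $z'\sim\mathrm{EX}(D_{i'})$, and let the auditor observe the costs $1-\ell_{j'}(h_{\theta^{(t-1)}},z')$ of $(i',j')$, $j'\in[m]$, which yields $w^{(t)}$. Return $h_{\overline\theta}$ with $\overline\theta=\frac1T\sum_{t=1}^T\theta^{(t)}$.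 **Theorem.** There is a universal constant $C>0$ such that in every such setting the algorithm makes exactly $2(T-1)\le 2T$ oracle calls on every execution, and with probability at least $1-\delta$ it returns $h_{\overline\theta}$ with $\overline\theta\in\Theta$ that is $\epsilon$-optimal for $$\epsilon=C\sqrt{\frac{\gamma_T(\mathcal Q_\Theta)+n\log(mn/\delta)+R\log(1/\delta)}{T}}.$$ -/

import Mathlib

open MeasureTheory
open scoped ENNReal

noncomputable section

namespace MDL

/-! ### Randomized algorithms with access to example oracles -/

/-- A randomized algorithm with output in `α`.  It reaches the data only through calls to the example
oracles `EX (D i)`, `i : ι`, each of which returns one datapoint in `Z`; its internal randomness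
consists of draws from explicitly given distributions on the finite type `A`. -/
inductive Prog (ι A Z α : Type*) [Fintype A] where
  | done (x : α) : Prog ι A Z α
  | call (i : ι) (k : Z → Prog ι A Z α) : Prog ι A Z α
  | draw (w : stdSimplex ℝ A) (k : A → Prog ι A Z α) : Prog ι A Z α

variable {ι A Z α : Type*} [Fintype A]

open Classical in
/-- The probability that the output lies in `S` when every call to oracle `i` returns a fresh
datapoint, distributed as `D i` and independent of everything that happened before, and every draw
from `w` is a fresh draw with the probabilities `w`. -/
def Prog.prob [MeasurableSpace Z] (D : ι → Measure Z) (S : Set α) : Prog ι A Z α → ℝ≥0∞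
  | .done x => if x ∈ S then 1 else 0
  | .call i k => ∫⁻ z, (k z).prob D S ∂(D i)
  | .draw w k => ∑ a, ENNReal.ofReal (w a) * (k a).prob D S

/-- On every execution the algorithm makes exactly `N` oracle calls. -/
def Prog.CallsExactly : Prog ι A Z α → ℕ → Prop
  | .done _, N => N = 0
  | .call _ k, N => ∃ N', N = N' + 1 ∧ ∀ z, (k z).CallsExactly N'
  | .draw _ k, N => ∀ a, (k a).CallsExactly N

/-! ### Multi-distribution learning problems -/

variable {n m : ℕ} {H E : Type*}

/-- The expected loss of the hypothesis `f` on the distribution `P`. -/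
def risk [MeasurableSpace Z] (P : Measure Z) (l : H → Z → ℝ) (f : H) : ℝ := ∫ z, l f z ∂P

/-- The largest expected loss of `f` over all distributions and losses. -/
def worstRisk [MeasurableSpace Z] (D : Fin n → Measure Z) (l : Fin m → H → Z → ℝ) (f : H) : ℝ :=
  ⨆ p : Fin n × Fin m, risk (D p.1) (l p.2) f

/-- The optimal worst-case expected loss over the class `F`. -/
def opt [MeasurableSpace Z] (D : Fin n → Measure Z) (l : Fin m → H → Z → ℝ) (F : Set H) : ℝ :=
  sInf (worstRisk D l '' F)

/-- `f` is `ε`-optimal for the problem `(D, l, F)`. -/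
def IsEpsOptimal [MeasurableSpace Z] (D : Fin n → Measure Z) (l : Fin m → H → Z → ℝ) (F : Set H)
    (ε : ℝ) (f : H) : Prop :=
  worstRisk D l f ≤ opt D l F + ε

variable [NormedAddCommGroup E] [NormedSpace ℝ E]

/-- The hypothesis class is `{h θ | θ ∈ Θ}` with `Θ` convex and compact, the losses are `[0,1]`-valued,
and, as functions of `θ ∈ Θ`, they are convex and differentiable with gradient `grad` of (dual) norm
at most `1`.  The gradient is a functional on `E`; the norm of `E` measures the parameters.  (If `Θ`
has empty interior, then `grad` is one choice of the gradient, which need not be unique.) -/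
structure SmoothConvex [MeasurableSpace E] [MeasurableSpace Z] (Θ : Set E) (h : E → H)
    (l : Fin m → H → Z → ℝ) (grad : Fin m → E → Z → (E →L[ℝ] ℝ)) : Prop where
  nonempty : Θ.Nonempty
  isCompact : IsCompact Θ
  convex : Convex ℝ Θ
  loss_mem : ∀ j, ∀ θ ∈ Θ, ∀ z, l j (h θ) z ∈ Set.Icc (0 : ℝ) 1
  loss_measurable : ∀ j, ∀ θ ∈ Θ, Measurable (l j (h θ))
  loss_convex : ∀ j z, ConvexOn ℝ Θ (fun θ => l j (h θ) z)
  hasGrad : ∀ j, ∀ θ ∈ Θ, ∀ z, HasFDerivWithinAt (fun θ' => l j (h θ') z) (grad j θ z) Θ θ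
  grad_measurable : ∀ j, Measurable (fun p : Θ × Z => grad j (p.1 : E) p.2)
  grad_norm_le : ∀ j, ∀ θ ∈ Θ, ∀ z, ‖grad j θ z‖ ≤ 1

/-! ### Online learning on `Θ` -/

/-- An online learning algorithm: it maps the linear costs of the past rounds, in chronological
order, to the next action in `Θ`. -/
structure OnlineLearner [MeasurableSpace E] (Θ : Set E) where
  act : List (E →L[ℝ] ℝ) → Θ
  measurable_act : ∀ t : ℕ,
    Measurable (fun c : Fin t → (E →L[ℝ] ℝ) => (act (List.ofFn c) : E))

/-- The regret of the actions `a` against the linear costs `c` on the action set `Θ`. -/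
def regret (Θ : Set E) {T : ℕ} (a : Fin T → E) (c : Fin T → (E →L[ℝ] ℝ)) : ℝ :=
  ∑ t, c t (a t) - sInf ((fun u => ∑ t, c t u) '' Θ)

/-- `Q` has the regret guarantee `g` over `T` rounds: its regret is at most `√(g T)` on every sequence
of `T` linear costs of norm at most `1`. -/
def OnlineLearner.HasRegretGuarantee [MeasurableSpace E] {Θ : Set E} (Q : OnlineLearner Θ) (T : ℕ)
    (g : ℝ) : Prop :=
  0 ≤ g ∧ ∀ c : Fin T → (E →L[ℝ] ℝ), (∀ t, ‖c t‖ ≤ 1) →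
    regret Θ (fun t => (Q.act ((List.ofFn c).take t) : E)) c ≤ √(g * T)

/-! ### High-probability ELP for the partition of `Fin n × Fin m` into the groups `{i} × Fin m` -/

/-- Exponential weights with learning rate `η` for the cumulative costs `L`. -/
def hedge [Nonempty A] (η : ℝ) (L : A → ℝ) : stdSimplex ℝ A :=
  ⟨fun a => Real.exp (-(η * L a)) / ∑ b, Real.exp (-(η * L b)), by
    have hpos : 0 < ∑ b, Real.exp (-(η * L b)) :=
      Finset.sum_pos (fun b _ => Real.exp_pos _) Finset.univ_nonempty
    refine ⟨fun a => by positivity, ?_⟩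
    rw [← Finset.sum_div, div_self hpos.ne']⟩

/-- The probability of the group `i`, that is, the probability that the costs of the meta-actions
`(i, 1), …, (i, m)` are observed when the played meta-action is drawn from `w`. -/
def groupMass (w : stdSimplex ℝ (Fin n × Fin m)) (i : Fin n) : ℝ :=
  ∑ j, w (i, j)

/-- The exploration distribution of ELP: a solution `s` of the linear program that maximizes the
smallest probability with which the cost of a meta-action is observed. -/
def IsExploration (s : stdSimplex ℝ (Fin n × Fin m)) : Prop :=
  ∀ s' : stdSimplex ℝ (Fin n × Fin m),
    (⨅ a : Fin n × Fin m, groupMass s' a.1) ≤ ⨅ a : Fin n × Fin m, groupMass s a.1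

/-- The parameters of ELP: learning rate `η`, implicit exploration `lam`, explicit exploration rate
`ρ` and exploration distribution `s`. -/
structure ELP (n m : ℕ) where
  η : ℝ
  lam : ℝ
  ρ : unitInterval
  s : stdSimplex ℝ (Fin n × Fin m)

variable [NeZero n] [NeZero m]

/-- The distribution on meta-actions played by ELP for the cumulative cost estimates `L`. -/
def ELP.mix (B : ELP n m) (L : Fin n × Fin m → ℝ) : stdSimplex ℝ (Fin n × Fin m) :=
  ⟨fun a => (1 - (B.ρ : ℝ)) * hedge B.η L a
      + (B.ρ : ℝ) * B.s a,
    convex_stdSimplex ℝ (Fin n × Fin m) (hedge B.η L).2 B.s.2 (sub_nonneg.2 B.ρ.2.2) B.ρ.2.1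
      (sub_add_cancel _ _)⟩

/-- The update of the cumulative cost estimates after observing the costs `o.2 1, …, o.2 m` of the
meta-actions in the group `o.1`: importance weighting with implicit exploration. -/
def ELP.update (B : ELP n m) (L : Fin n × Fin m → ℝ) (o : Fin n × (Fin m → ℝ)) :
    Fin n × Fin m → ℝ :=
  fun a => L a + if a.1 = o.1 then o.2 a.2 / (groupMass (B.mix L) o.1 + B.lam) else 0

/-- The distribution played by ELP after the observations in `obs` (chronological order), each of
which consists of a group and of the costs of the meta-actions in this group. -/
def ELP.act (B : ELP n m) (obs : List (Fin n × (Fin m → ℝ))) : stdSimplex ℝ (Fin n × Fin m) :=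
  B.mix (obs.foldl B.update 0)

/-- The learning rate of ELP for `T` rounds and failure probability `δ`. -/
def elpRate (n m T : ℕ) (δ : ℝ) : ℝ := √(Real.log (m * n / δ) / (n * T))

/-! ### The multi-distribution learning algorithm -/

/-- `N` rounds of the game, then `k`.  Here `cs` are the linear costs that the learner has received
so far and `obs` the observations of the auditor.  In a round with `θ = Q(cs)` and `w = B(obs)`, a pair
`(i, j)` is drawn from `w` and a datapoint `z` from `EX (D i)`, and the learner receives the cost
`∇ l_j(h_θ, z)`; independently, the auditor plays a meta-action drawn from `w`, in the group `i'`, one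
datapoint `z'` is drawn from `EX (D i')`, and the auditor observes `1 - l_{j'}(h_θ, z')` for all
`j'`. -/
def rounds [MeasurableSpace E] {Θ : Set E} (h : E → H) (l : Fin m → H → Z → ℝ)
    (grad : Fin m → E → Z → (E →L[ℝ] ℝ)) (Q : OnlineLearner Θ) (B : ELP n m)
    (k : List (E →L[ℝ] ℝ) → Prog (Fin n) (Fin n × Fin m) Z α) :
    ℕ → List (E →L[ℝ] ℝ) → List (Fin n × (Fin m → ℝ)) → Prog (Fin n) (Fin n × Fin m) Z α
  | 0, cs, _ => k cs
  | N + 1, cs, obs =>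
    .draw (B.act obs) fun a => .call a.1 fun z =>
    .draw (B.act obs) fun b => .call b.1 fun z' =>
      rounds h l grad Q B k N
        (cs ++ [grad a.2 (Q.act cs : E) z])
        (obs ++ [(b.1, fun j' => 1 - l j' (h (Q.act cs : E)) z')])

/-- The algorithm with `T` iterations: `θ₁ = Q(∅)`, then for `t = 2, …, T` one round as above, after
which `θ_t = Q(c₁, …, c_{t-1})`; the output is the parameter `(θ₁ + ⋯ + θ_T) / T`. -/
def algorithm [MeasurableSpace E] {Θ : Set E} (h : E → H) (l : Fin m → H → Z → ℝ)
    (grad : Fin m → E → Z → (E →L[ℝ] ℝ)) (Q : OnlineLearner Θ) (B : ELP n m) (T : ℕ) :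
    Prog (Fin n) (Fin n × Fin m) Z E :=
  rounds h l grad Q B
    (fun cs => .done ((T : ℝ)⁻¹ • ∑ t ∈ Finset.range T, (Q.act (cs.take t) : E))) (T - 1) [] []

end MDL

end

/-! The algorithm plays a zero-sum game in which both players have small regret. By Jensen
(`risk_output_le`), `T` times the risk of the averaged parameter at any pair is at most the sum of
the risks of the actions. The auditor's regret (`pathSum_risk_le`, `auditor_le`) bounds this sum by
the mean risks under the auditor's own distributions, and the learner's regret
(`pathSum_meanRisk_le`) bounds those by `T` times the worst risk of a near-optimal comparator `u`.

Randomness enters through four kinds of deviation: the learner's costs, the cost estimate of each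
meta-action, the inverse masses of the observed groups, and their conditional mean costs. The
exponential of each is a nonnegative supermartingale started at 1, and `potential` is a weighted sum
of them. `ofReal_one_sub_le_prob_rounds` shows by induction on the remaining rounds that success has
probability at least one minus the potential; this is Markov's inequality and the union bound in
one. The learner's deviation is measured on loss differences, which lie in `[-1, 1]`, and only then
compared with linear costs by convexity, so its increments do not grow with the diameter of `Θ`.

There are `T` actions but only `T - 1` rounds of feedback. The learner's last action is charged
through a fictitious final cost, the auditor's through the trivial bound 1. As `η * (n * η * T) =
log (m * n / δ)`, every regret term other than the learner's own is a multiple of `n * η * T`, that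
is, of `n * η` after division by `T`. -/

namespace MDL

/-! ### Lower bounds on the success probability of a program -/

section Prog

variable {ι A Z α : Type*} [Fintype A] [MeasurableSpace Z]

/-- Failure is measured by a real `v` that may exceed 1; `ENNReal.ofReal` then truncates to 0 and
the claim is empty. -/
theorem Prog.ofReal_one_sub_le_prob_done {D : ι → Measure Z} {S : Set α} {x : α} {v : ℝ}
    (hv : v < 1 → x ∈ S) (hv0 : 0 ≤ v) :
    ENNReal.ofReal (1 - v) ≤ (Prog.done x : Prog ι A Z α).prob D S := by
  rw [Prog.prob]
  split_ifs with h
  · exact ENNReal.ofReal_le_one.2 (by linarith)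
  · have : 1 ≤ v := not_lt.1 fun h' => h (hv h')
    simp [this]

/-- Monotonicity of `lintegral` needs no measurability, so only `v` has to be integrable, not the
success probability of the continuation. Truncating at 0 can only increase the integral of `1 - v`.
-/
theorem Prog.ofReal_one_sub_le_prob_call {D : ι → Measure Z} [∀ i, IsProbabilityMeasure (D i)]
    {S : Set α} {i : ι} {k : Z → Prog ι A Z α} {v : Z → ℝ} (hv : Integrable v (D i))
    (hk : ∀ z, ENNReal.ofReal (1 - v z) ≤ (k z).prob D S) :
    ENNReal.ofReal (1 - ∫ z, v z ∂(D i)) ≤ (Prog.call i k).prob D S := by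
  rw [Prog.prob]
  refine le_trans ?_ (lintegral_mono hk)
  have hi : Integrable (fun z => 1 - v z) (D i) := (integrable_const 1).sub hv
  have h1 : 1 - ∫ z, v z ∂(D i) = ∫ z, (1 - v z) ∂(D i) := by
    rw [integral_sub (integrable_const 1) hv]; simp
  rw [h1, integral_eq_lintegral_pos_part_sub_lintegral_neg_part hi]
  refine (ENNReal.ofReal_le_ofReal (sub_le_self _ ENNReal.toReal_nonneg)).trans ?_
  exact ENNReal.ofReal_toReal_le

theorem Prog.ofReal_one_sub_le_prob_draw {D : ι → Measure Z} {S : Set α} {w : stdSimplex ℝ A}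
    {k : A → Prog ι A Z α} {v : A → ℝ}
    (hk : ∀ a, ENNReal.ofReal (1 - v a) ≤ (k a).prob D S) :
    ENNReal.ofReal (1 - ∑ a, w a * v a) ≤ (Prog.draw w k).prob D S := by
  rw [Prog.prob]
  have h1 : 1 - ∑ a, w a * v a = ∑ a, w a * (1 - v a) := by
    have : ∑ a, w a = 1 := w.2.2
    simp only [mul_sub, mul_one, Finset.sum_sub_distrib, this]
  rw [h1]
  have h2 : ENNReal.ofReal (∑ a, w a * (1 - v a)) ≤
      ENNReal.ofReal (∑ a, w a * max (1 - v a) 0) :=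
    ENNReal.ofReal_le_ofReal (Finset.sum_le_sum fun a _ =>
      mul_le_mul_of_nonneg_left (le_max_left _ _) (w.2.1 a))
  refine h2.trans ?_
  rw [ENNReal.ofReal_sum_of_nonneg fun a _ =>
    mul_nonneg (show 0 ≤ w a from w.2.1 a) (le_max_right _ _)]
  refine Finset.sum_le_sum fun a _ => ?_
  rw [ENNReal.ofReal_mul (show 0 ≤ w a from w.2.1 a)]
  gcongr
  refine le_trans ?_ (hk a)
  rw [ENNReal.ofReal_max]
  simp

end Prog

/-! ### Sums along a history -/

section PathSum

variable {X M : Type*}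

/-- The sum of `f past x` over the entries `x` of a history, most recent entry first, where `past`
is the history before `x`. -/
def pathSum [AddCommMonoid M] (f : List X → X → M) : List X → M
  | [] => 0
  | x :: xs => pathSum f xs + f xs x

@[simp] theorem pathSum_nil [AddCommMonoid M] (f : List X → X → M) : pathSum f [] = 0 := rfl

@[simp] theorem pathSum_cons [AddCommMonoid M] (f : List X → X → M) (x : X) (xs : List X) :
    pathSum f (x :: xs) = pathSum f xs + f xs x := rfl

theorem pathSum_sub [AddCommGroup M] (f f' : List X → X → M) (xs : List X) :
    pathSum (fun past x => f past x - f' past x) xs = pathSum f xs - pathSum f' xs := by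
  induction xs with
  | nil => simp
  | cons x xs ih => simp only [pathSum_cons, ih, add_sub_add_comm]

theorem pathSum_mul_left (c : ℝ) (f : List X → X → ℝ) (xs : List X) :
    pathSum (fun past x => c * f past x) xs = c * pathSum f xs := by
  induction xs with
  | nil => simp
  | cons x xs ih => simp only [pathSum_cons, ih, mul_add]

theorem pathSum_const (c : ℝ) (xs : List X) : pathSum (fun _ _ => c) xs = xs.length * c := by
  induction xs with
  | nil => simp
  | cons x xs ih => simp only [pathSum_cons, ih, List.length_cons]; push_cast; ring

theorem pathSum_le_length_mul {f : List X → X → ℝ} {c : ℝ} (hf : ∀ xs x, f xs x ≤ c)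
    (xs : List X) : pathSum f xs ≤ xs.length * c := by
  induction xs with
  | nil => simp
  | cons x xs ih => simp only [pathSum_cons, List.length_cons]; push_cast; linarith [hf xs x]

end PathSum

/-! ### Exponential inequalities and moments -/

section Exponential

/-- Follows from `exp (-x) ≤ 1 / (1 + x)` and `(1 + x) * (1 - x + x ^ 2) = 1 + x ^ 3`. No upper
bound on `x` is imposed, since `η` times an estimated cost may exceed 1. -/
theorem exp_neg_le_of_nonneg {x : ℝ} (hx : 0 ≤ x) : Real.exp (-x) ≤ 1 - x + x ^ 2 := by
  rw [Real.exp_neg]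
  have h1 : x + 1 ≤ Real.exp x := Real.add_one_le_exp x
  have h2 : 0 < 1 - x + x ^ 2 := by nlinarith [sq_nonneg (x - 1)]
  rw [inv_le_iff_one_le_mul₀ (Real.exp_pos x)]
  nlinarith [mul_le_mul_of_nonneg_left h1 h2.le, pow_nonneg hx 3]

theorem exp_le_of_abs_le_one {x : ℝ} (hx : |x| ≤ 1) : Real.exp x ≤ 1 + x + x ^ 2 := by
  have := (abs_le.1 (Real.abs_exp_sub_one_sub_id_le hx)).2
  linarith

/-- This is `2 * x / (x + 2) ≤ log (1 + x)` at `x = η * c / W`, combined with `c ≤ 1`. The bias `η /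
2` in the denominator makes the exponential moment linear in `c / W` without any quantitative lower
bound on `W`. -/
theorem exp_implicit_exploration_le {η W c : ℝ} (hη : 0 < η) (hW : 0 < W) (hc : 0 ≤ c)
    (hc1 : c ≤ 1) : Real.exp (η * (c / (W + η / 2))) ≤ 1 + η * c / W := by
  have hx : 0 ≤ η * c / W := by positivity
  have h := Real.le_log_one_add_of_nonneg hx
  rw [Real.le_log_iff_exp_le (by positivity)] at h
  refine (Real.exp_le_exp.2 ?_).trans h
  have : 2 * (η * c / W) / (η * c / W + 2) = η * (c / (W + η * c / 2)) := by
    field_simp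
    ring
  rw [this]
  have : η * c ≤ η := by nlinarith
  gcongr

variable {A Z : Type*} [Fintype A] [MeasurableSpace Z]

theorem integrable_of_measurable_abs_le {P : Measure Z} [IsFiniteMeasure P] {f : Z → ℝ} {C : ℝ}
    (hf : Measurable f) (hC : ∀ z, |f z| ≤ C) : Integrable f P :=
  Integrable.of_bound hf.aestronglyMeasurable C (Filter.Eventually.of_forall hC)

theorem integrable_exp_of_le {P : Measure Z} [IsFiniteMeasure P] {f : Z → ℝ} {C : ℝ}
    (hf : Measurable f) (hC : ∀ z, f z ≤ C) : Integrable (fun z => Real.exp (f z)) P :=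
  integrable_of_measurable_abs_le hf.exp (C := Real.exp C) fun z => by
    rw [Real.abs_exp]
    exact Real.exp_le_exp.2 (hC z)

/-- If `a` is drawn from `w` and `z` from `P a`, then the mean of `F a z` is at most `v`. -/
def MeanLE (w : stdSimplex ℝ A) (P : A → Measure Z) (F : A → Z → ℝ) (v : ℝ) : Prop :=
  (∀ a, Integrable (F a) (P a)) ∧ ∑ a, w a * ∫ z, F a z ∂(P a) ≤ v

theorem MeanLE.add {w : stdSimplex ℝ A} {P : A → Measure Z} {F G : A → Z → ℝ} {v v' : ℝ}
    (hF : MeanLE w P F v) (hG : MeanLE w P G v') :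
    MeanLE w P (fun a z => F a z + G a z) (v + v') := by
  refine ⟨fun a => (hF.1 a).add (hG.1 a), ?_⟩
  simp only [integral_add (hF.1 _) (hG.1 _), mul_add, Finset.sum_add_distrib]
  exact add_le_add hF.2 hG.2

theorem MeanLE.const_mul {w : stdSimplex ℝ A} {P : A → Measure Z} {F : A → Z → ℝ} {v c : ℝ}
    (hF : MeanLE w P F v) (hc : 0 ≤ c) : MeanLE w P (fun a z => c * F a z) (c * v) := by
  refine ⟨fun a => (hF.1 a).const_mul c, ?_⟩
  simp only [integral_const_mul, mul_left_comm _ c, ← Finset.mul_sum]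
  exact mul_le_mul_of_nonneg_left hF.2 hc

theorem MeanLE.sum {κ : Type*} [Fintype κ] {w : stdSimplex ℝ A} {P : A → Measure Z}
    {F : κ → A → Z → ℝ} {v : κ → ℝ} (hF : ∀ k, MeanLE w P (F k) (v k)) :
    MeanLE w P (fun a z => ∑ k, F k a z) (∑ k, v k) := by
  refine ⟨fun a => integrable_finsetSum _ fun k _ => (hF k).1 a, ?_⟩
  simp only [integral_finsetSum _ fun k _ => (hF k).1 _, Finset.mul_sum]
  rw [Finset.sum_comm]
  exact Finset.sum_le_sum fun k _ => (hF k).2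

/-- Exponential moment bound for the deviation of a `[-1, 1]`-valued variable below its mean. -/
theorem meanLE_exp_sub_one (w : stdSimplex ℝ A) (P : A → Measure Z)
    [∀ a, IsProbabilityMeasure (P a)] {f : A → Z → ℝ} (hf : ∀ a, Measurable (f a))
    (hf1 : ∀ a z, |f a z| ≤ 1) {η : ℝ} (hη : 0 ≤ η) (hη1 : η ≤ 1) :
    MeanLE w P
      (fun a z => Real.exp (η * (∑ b, w b * ∫ y, f b y ∂(P b) - f a z) - η ^ 2)) 1 := by
  set μ := ∑ b, w b * ∫ y, f b y ∂(P b) with hμ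
  refine ⟨fun a => integrable_exp_of_le (C := η * (μ + 1))
    ((((hf a).const_sub μ).const_mul η).sub_const _) fun z => ?_, ?_⟩
  · nlinarith [(abs_le.1 (hf1 a z)).1, sq_nonneg η]
  -- Expanding around 0 rather than around the mean keeps the exponent in `[-1, 1]`; the factor
  -- pulled out is cancelled after averaging by `1 + y ≤ exp y`.
  have key : ∀ a, ∫ z, Real.exp (η * (μ - f a z) - η ^ 2) ∂(P a) ≤
      Real.exp (η * μ - η ^ 2) * (1 + η ^ 2 - η * ∫ y, f a y ∂(P a)) := by
    intro a
    have hfi : Integrable (f a) (P a) := integrable_of_measurable_abs_le (hf a) (hf1 a)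
    have h1 : ∫ z, Real.exp (η * (μ - f a z) - η ^ 2) ∂(P a) ≤
        ∫ z, Real.exp (η * μ - η ^ 2) * (1 + η ^ 2 - η * f a z) ∂(P a) := by
      refine integral_mono_of_nonneg (Filter.Eventually.of_forall fun z => (Real.exp_pos _).le)
        ((((integrable_const _).sub (hfi.const_mul η))).const_mul _)
        (Filter.Eventually.of_forall fun z => ?_)
      have h2 : η * (μ - f a z) - η ^ 2 = (η * μ - η ^ 2) + (-(η * f a z)) := by ring
      have h3 : |-(η * f a z)| ≤ 1 := by
        rw [abs_neg, abs_mul, abs_of_nonneg hη]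
        exact mul_le_one₀ hη1 (abs_nonneg _) (hf1 a z)
      have h4 := exp_le_of_abs_le_one h3
      have h5 : f a z ^ 2 ≤ 1 := by
        rw [← sq_abs]; exact pow_le_one₀ (abs_nonneg _) (hf1 a z)
      simp only
      rw [h2, Real.exp_add]
      refine mul_le_mul_of_nonneg_left (h4.trans ?_) (Real.exp_pos _).le
      nlinarith [sq_nonneg η]
    refine h1.trans (le_of_eq ?_)
    rw [integral_const_mul, integral_sub (integrable_const _) (hfi.const_mul η),
      integral_const_mul]
    simp
  have hw : ∑ a, w a = 1 := w.2.2
  calc ∑ a, w a * ∫ z, Real.exp (η * (μ - f a z) - η ^ 2) ∂(P a)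
      ≤ ∑ a, w a * (Real.exp (η * μ - η ^ 2) * (1 + η ^ 2 - η * ∫ y, f a y ∂(P a))) :=
        Finset.sum_le_sum fun a _ => mul_le_mul_of_nonneg_left (key a) (w.2.1 a)
    _ = Real.exp (η * μ - η ^ 2) * ((1 + η ^ 2) * ∑ a, w a - η * μ) := by
        rw [hμ, Finset.mul_sum, Finset.mul_sum, ← Finset.sum_sub_distrib, Finset.mul_sum]
        exact Finset.sum_congr rfl fun a _ => by ring
    _ ≤ Real.exp (η * μ - η ^ 2) * Real.exp (-(η * μ - η ^ 2)) := by
        refine mul_le_mul_of_nonneg_left ?_ (Real.exp_pos _).le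
        rw [hw]
        linarith [Real.add_one_le_exp (-(η * μ - η ^ 2))]
    _ = 1 := by rw [← Real.exp_add]; simp

end Exponential

/-! ### Exponential moments of importance-weighted observations -/

section Observation

variable {n m : ℕ} {Z : Type*} [MeasurableSpace Z]

theorem sum_mul_fst (w : stdSimplex ℝ (Fin n × Fin m)) (f : Fin n → ℝ) :
    ∑ b, w b * f b.1 = ∑ i, groupMass w i * f i := by
  rw [Fintype.sum_prod_type]
  simp only [groupMass, Finset.sum_mul]

theorem sum_groupMass (w : stdSimplex ℝ (Fin n × Fin m)) : ∑ i, groupMass w i = 1 := by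
  have := sum_mul_fst w fun _ => 1
  simp only [mul_one] at this
  rw [← this]; exact w.2.2

/-- Exponential moment bound for the cost estimate with implicit exploration of a meta-action in
the group `i`. -/
theorem meanLE_exp_estimate_one (w : stdSimplex ℝ (Fin n × Fin m))
    (hw : ∀ i, 0 < groupMass w i) (D : Fin n → Measure Z) [∀ i, IsProbabilityMeasure (D i)]
    (i : Fin n) {c : Z → ℝ} (hc : Measurable c) (hc0 : ∀ z, c z ∈ Set.Icc (0 : ℝ) 1)
    {η : ℝ} (hη : 0 < η) :
    MeanLE w (fun b => D b.1)
      (fun b z => Real.exp (η * ((if i = b.1 then c z / (groupMass w b.1 + η / 2) else 0)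
        - ∫ y, c y ∂(D i)))) 1 := by
  set μ := ∫ y, c y ∂(D i) with hμ
  refine ⟨fun b => integrable_exp_of_le (C := η * (1 / (groupMass w b.1 + η / 2) - μ)) ?_
    fun z => ?_, ?_⟩
  · refine Measurable.const_mul (Measurable.sub_const ?_ _) _
    split_ifs
    · exact hc.div_const _
    · exact measurable_const
  · have := hw b.1
    refine mul_le_mul_of_nonneg_left (sub_le_sub_right ?_ _) hη.le
    split_ifs
    · exact div_le_div_of_nonneg_right (hc0 z).2 (by positivity)
    · positivity
  have hci : ∀ j, Integrable c (D j) := fun j => integrable_of_measurable_abs_le hc fun z => by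
    rw [abs_of_nonneg (hc0 z).1]; exact (hc0 z).2
  -- The estimate vanishes outside the group `i`. Inside, the gain is at most `η * μ` over the group
  -- mass, which cancels when the group is drawn with that mass.
  have key : ∀ j, ∫ z, Real.exp (η * ((if i = j then c z / (groupMass w j + η / 2) else 0) - μ))
      ∂(D j) ≤ Real.exp (-(η * μ)) * (1 + if i = j then η * μ / groupMass w j else 0) := by
    intro j
    split_ifs with hij
    · subst hij
      have h1 : ∫ z, Real.exp (η * (c z / (groupMass w i + η / 2) - μ)) ∂(D i) ≤
          ∫ z, Real.exp (-(η * μ)) * (1 + η / groupMass w i * c z) ∂(D i) := by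
        refine integral_mono_of_nonneg (Filter.Eventually.of_forall fun z => (Real.exp_pos _).le)
          (((integrable_const _).add ((hci i).const_mul _)).const_mul _)
          (Filter.Eventually.of_forall fun z => ?_)
        simp only
        rw [mul_sub, sub_eq_neg_add, Real.exp_add]
        refine mul_le_mul_of_nonneg_left ?_ (Real.exp_pos _).le
        refine (exp_implicit_exploration_le hη (hw i) (hc0 z).1 (hc0 z).2).trans (le_of_eq ?_)
        ring
      refine h1.trans (le_of_eq ?_)
      rw [integral_const_mul, integral_add (integrable_const _) ((hci i).const_mul _),
        integral_const_mul, ← hμ]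
      simp only [integral_const, probReal_univ, smul_eq_mul, mul_one]
      ring
    · simp
  calc _ ≤ ∑ b, w b * (Real.exp (-(η * μ)) *
        (1 + if i = b.1 then η * μ / groupMass w b.1 else 0)) :=
        Finset.sum_le_sum fun b _ => mul_le_mul_of_nonneg_left (key b.1) (w.2.1 b)
    _ = Real.exp (-(η * μ)) * (1 + η * μ) := by
        rw [sum_mul_fst w fun j => Real.exp (-(η * μ)) *
          (1 + if i = j then η * μ / groupMass w j else 0)]
        have h2 : ∀ j, groupMass w j * (Real.exp (-(η * μ)) *
            (1 + if i = j then η * μ / groupMass w j else 0)) =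
            Real.exp (-(η * μ)) * (groupMass w j + if i = j then η * μ else 0) := by
          intro j
          have := (hw j).ne'
          split_ifs
          · field_simp
          · ring
        rw [Finset.sum_congr rfl fun j _ => h2 j, ← Finset.mul_sum, Finset.sum_add_distrib,
          sum_groupMass]
        simp
    _ ≤ Real.exp (-(η * μ)) * Real.exp (η * μ) := by
        refine mul_le_mul_of_nonneg_left ?_ (Real.exp_pos _).le
        linarith [Real.add_one_le_exp (η * μ)]
    _ = 1 := by rw [← Real.exp_add]; simp

/-- Exponential moment bound for the inverse mass of the observed group. -/
theorem meanLE_exp_inv_groupMass_one (w : stdSimplex ℝ (Fin n × Fin m))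
    (hw : ∀ i, 0 < groupMass w i) (D : Fin n → Measure Z) [∀ i, IsProbabilityMeasure (D i)]
    {η : ℝ} (hη : 0 < η) :
    MeanLE w (fun b => D b.1)
      (fun b _ => Real.exp (η * (1 / (groupMass w b.1 + η / 2) - n))) 1 := by
  refine ⟨fun b => integrable_const _, ?_⟩
  simp only [integral_const, probReal_univ, smul_eq_mul, one_mul]
  rw [sum_mul_fst w fun j => Real.exp (η * (1 / (groupMass w j + η / 2) - n))]
  -- The implicit-exploration bound with cost 1: each of the `n` groups adds `η` to its mass.
  calc _ ≤ ∑ j, Real.exp (-(η * n)) * (groupMass w j + η) := by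
        refine Finset.sum_le_sum fun j _ => ?_
        rw [mul_sub, sub_eq_neg_add, Real.exp_add, mul_left_comm]
        refine mul_le_mul_of_nonneg_left ?_ (Real.exp_pos _).le
        refine (mul_le_mul_of_nonneg_left (exp_implicit_exploration_le hη (hw j) zero_le_one
          le_rfl) (hw j).le).trans (le_of_eq ?_)
        have := (hw j).ne'
        field_simp
    _ = Real.exp (-(η * n)) * (1 + η * n) := by
        rw [← Finset.mul_sum, Finset.sum_add_distrib, sum_groupMass]
        simp [mul_comm]
    _ ≤ Real.exp (-(η * n)) * Real.exp (η * n) := by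
        refine mul_le_mul_of_nonneg_left ?_ (Real.exp_pos _).le
        linarith [Real.add_one_le_exp (η * n)]
    _ = 1 := by rw [← Real.exp_add]; simp

end Observation

/-! ### Reversed histories and chronological transcripts -/

section Transcript

variable {n m : ℕ} {E : Type*} [NormedAddCommGroup E] [NormedSpace ℝ E]

/-- What the learner and the auditor receive in one round. -/
abbrev Feedback (n m : ℕ) (E : Type*) [NormedAddCommGroup E] [NormedSpace ℝ E] :=
  (E →L[ℝ] ℝ) × (Fin n × (Fin m → ℝ))

/-- The linear costs of a history (most recent round first) in chronological order. -/
def costs (xs : List (Feedback n m E)) : List (E →L[ℝ] ℝ) := (xs.map Prod.fst).reverse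

/-- The observations of a history (most recent round first) in chronological order. -/
def observations (xs : List (Feedback n m E)) : List (Fin n × (Fin m → ℝ)) :=
  (xs.map Prod.snd).reverse

@[simp] theorem costs_nil : costs ([] : List (Feedback n m E)) = [] := rfl

@[simp] theorem costs_cons (x : Feedback n m E) (xs : List (Feedback n m E)) :
    costs (x :: xs) = costs xs ++ [x.1] := by simp [costs]

@[simp] theorem observations_nil : observations ([] : List (Feedback n m E)) = [] := rfl

@[simp] theorem observations_cons (x : Feedback n m E) (xs : List (Feedback n m E)) :
    observations (x :: xs) = observations xs ++ [x.2] := by simp [observations]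

@[simp] theorem length_costs (xs : List (Feedback n m E)) : (costs xs).length = xs.length := by
  simp [costs]

/-- In every round the linear cost has norm at most `1` and the observed costs lie in `[0, 1]`. -/
def Bounded (xs : List (Feedback n m E)) : Prop :=
  ∀ x ∈ xs, ‖x.1‖ ≤ 1 ∧ ∀ j, x.2.2 j ∈ Set.Icc (0 : ℝ) 1

/-- Translates the chronological prefixes on which the learner acts into the reversed histories on
which the inductions run. -/
theorem sum_range_take_costs {M : Type*} [AddCommMonoid M] (f : List (E →L[ℝ] ℝ) → M)
    (xs : List (Feedback n m E)) :
    ∑ t ∈ Finset.range xs.length, f ((costs xs).take t) =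
      pathSum (fun past _ => f (costs past)) xs := by
  induction xs with
  | nil => simp
  | cons x xs ih =>
    rw [List.length_cons, Finset.sum_range_succ, pathSum_cons, ← ih]
    congr 1
    · refine Finset.sum_congr rfl fun t ht => ?_
      rw [costs_cons, List.take_append_of_le_length]
      rw [length_costs]; exact (Finset.mem_range.1 ht).le
    · rw [costs_cons, List.take_append_of_le_length (by simp), List.take_of_length_le (by simp)]

theorem sum_fin_take_costs (φ : List (E →L[ℝ] ℝ) → (E →L[ℝ] ℝ) → ℝ) :
    ∀ (T : ℕ) (c : Fin T → (E →L[ℝ] ℝ)) (xs : List (Feedback n m E)), costs xs = List.ofFn c →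
      ∑ t : Fin T, φ ((List.ofFn c).take t) (c t) = pathSum (fun past x => φ (costs past) x.1) xs
  | 0, c, [], _ => by simp
  | 0, c, x :: xs, h => by simp at h
  | T + 1, c, [], h => by simp at h
  | T + 1, c, x :: xs, h => by
    rw [costs_cons, List.ofFn_succ', List.concat_eq_append] at h
    obtain ⟨h1, h2⟩ := List.append_inj' h rfl
    rw [Fin.sum_univ_castSucc, pathSum_cons, h1, ← sum_fin_take_costs φ T _ xs h1,
      List.ofFn_succ', List.concat_eq_append]
    simp only [List.cons.injEq, and_true] at h2
    congr 1
    · refine Finset.sum_congr rfl fun t _ => ?_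
      rw [List.take_append_of_le_length (by simp)]
      rfl
    · rw [h2, List.take_append_of_le_length (by simp), List.take_of_length_le (by simp)]

end Transcript

/-- On the segment from `θ` to `u`, the derivative at the left endpoint is at most the slope of the
chord. Only the derivative within `Θ` is needed, so boundary points and empty interior are harmless.
-/
theorem sub_le_gradient {E : Type*} [NormedAddCommGroup E] [NormedSpace ℝ E] {Θ : Set E}
    {f : E → ℝ} {f' : E →L[ℝ] ℝ} {θ u : E}
    (hf : ConvexOn ℝ Θ f) (hθ : θ ∈ Θ) (hu : u ∈ Θ) (hf' : HasFDerivWithinAt f f' Θ θ) :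
    f θ - f u ≤ f' (θ - u) := by
  let γ : ℝ → E := AffineMap.lineMap θ u
  have hγ : HasDerivWithinAt γ (u - θ) (Set.Icc 0 1) 0 :=
    AffineMap.hasDerivWithinAt_lineMap
  have hmaps : Set.MapsTo γ (Set.Icc 0 1) Θ := fun t ht =>
    hf.1.segment_subset hθ hu (by rw [segment_eq_image_lineMap]; exact ⟨t, ht, rfl⟩)
  have h0 : γ 0 = θ := by simp [γ]
  have h1 : γ 1 = u := by simp [γ]
  have hd : HasDerivWithinAt (f ∘ γ) (f' (u - θ)) (Set.Icc 0 1) 0 :=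
    HasFDerivWithinAt.comp_hasDerivWithinAt 0 (by rw [h0]; exact hf') hγ hmaps
  have hc : ConvexOn ℝ (Set.Icc (0 : ℝ) 1) (f ∘ γ) :=
    (hf.comp_affineMap (AffineMap.lineMap θ u)).subset hmaps (convex_Icc 0 1)
  have := hc.le_slope_of_hasDerivWithinAt (Set.left_mem_Icc.2 zero_le_one)
    (Set.right_mem_Icc.2 zero_le_one) zero_lt_one hd
  rw [slope_def_field] at this
  simp only [Function.comp, h0, h1, sub_zero, div_one] at this
  have h2 : f' (θ - u) = -f' (u - θ) := by rw [← map_neg]; simp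
  linarith

/-! ### The learner's regret against a fixed comparator -/

section Learner

variable {n m : ℕ} {E : Type*} [NormedAddCommGroup E] [NormedSpace ℝ E] [MeasurableSpace E]

theorem OnlineLearner.HasRegretGuarantee.pathSum_le {Θ : Set E} {Q : OnlineLearner Θ} {g : ℝ}
    (hΘ : IsCompact Θ) {xs : List (Feedback n m E)} (hg : Q.HasRegretGuarantee xs.length g)
    (hxs : ∀ x ∈ xs, ‖x.1‖ ≤ 1) {u : E} (hu : u ∈ Θ) :
    pathSum (fun past x => x.1 ((Q.act (costs past) : E) - u)) xs ≤ √(g * xs.length) := by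
  let c : Fin xs.length → (E →L[ℝ] ℝ) := fun t => (costs xs)[(t : ℕ)]'(by simp)
  have hc : costs xs = List.ofFn c := by
    apply List.ext_getElem
    · simp
    · intro i h1 h2; simp [c]
  have hc1 : ∀ t, ‖c t‖ ≤ 1 := by
    intro t
    have : c t ∈ costs xs := List.getElem_mem _
    simp only [costs, List.mem_reverse, List.mem_map] at this
    obtain ⟨x, hx, hxc⟩ := this
    rw [← hxc]; exact hxs x hx
  have h := hg.2 c hc1
  rw [← sum_fin_take_costs (fun l y => y ((Q.act l : E) - u)) _ c xs hc]
  refine le_trans ?_ h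
  unfold regret
  have hb : BddBelow ((fun u => ∑ t, c t u) '' Θ) :=
    (hΘ.image (continuous_finsetSum _ fun t _ => (c t).continuous)).bddBelow
  have := csInf_le hb ⟨u, hu, rfl⟩
  simp only [map_sub, Finset.sum_sub_distrib]
  simp only at this
  linarith

end Learner

/-! ### Deterministic regret analysis of ELP -/

section Auditor

variable {n m : ℕ}

theorem sum_mul_ite_fst (f : Fin n × Fin m → ℝ) (g : Fin m → ℝ) (i : Fin n) :
    ∑ a, f a * (if a.1 = i then g a.2 else 0) = ∑ j, f (i, j) * g j := by
  rw [Fintype.sum_prod_type, Finset.sum_eq_single i] <;> simp +contextual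

/-- The mean of the observed costs under `w` conditioned on the observed group. -/
noncomputable def groupMean (w : stdSimplex ℝ (Fin n × Fin m)) (o : Fin n × (Fin m → ℝ)) : ℝ :=
  ∑ j, w (o.1, j) / groupMass w o.1 * o.2 j

theorem groupMean_mem {w : stdSimplex ℝ (Fin n × Fin m)} {o : Fin n × (Fin m → ℝ)}
    (hw : 0 < groupMass w o.1) (ho : ∀ j, o.2 j ∈ Set.Icc (0 : ℝ) 1) :
    groupMean w o ∈ Set.Icc (0 : ℝ) 1 := by
  have h0 : ∀ j, 0 ≤ w (o.1, j) / groupMass w o.1 := fun j => div_nonneg (w.2.1 _) hw.le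
  refine ⟨Finset.sum_nonneg fun j _ => mul_nonneg (h0 j) (ho j).1, ?_⟩
  calc groupMean w o ≤ ∑ j, w (o.1, j) / groupMass w o.1 :=
        Finset.sum_le_sum fun j _ => mul_le_of_le_one_right (h0 j) (ho j).2
    _ = 1 := by rw [← Finset.sum_div]; exact div_self hw.ne'

variable [NeZero n] [NeZero m]

/-- Lets second moments under the exponential weights be charged, up to a factor 2, to the
observation probabilities of the distribution actually played. -/
theorem ELP.half_hedge_le_mix {B : ELP n m} (hρ : (B.ρ : ℝ) ≤ 1 / 2) (L : Fin n × Fin m → ℝ)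
    (a : Fin n × Fin m) : hedge B.η L a / 2 ≤ B.mix L a := by
  have h1 : 0 ≤ hedge B.η L a := (hedge B.η L).2.1 a
  have h2 : 0 ≤ B.ρ * B.s a := mul_nonneg B.ρ.2.1 (B.s.2.1 a)
  change _ ≤ (1 - (B.ρ : ℝ)) * hedge B.η L a + B.ρ * B.s a
  nlinarith

theorem hedge_pos (η : ℝ) (L : Fin n × Fin m → ℝ) (a : Fin n × Fin m) : 0 < hedge η L a := by
  change 0 < Real.exp (-(η * L a)) / ∑ b, Real.exp (-(η * L b))
  have : 0 < ∑ b, Real.exp (-(η * L b)) :=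
    Finset.sum_pos (fun b _ => Real.exp_pos _) Finset.univ_nonempty
  positivity

theorem ELP.groupMass_mix_pos {B : ELP n m} (hρ : (B.ρ : ℝ) ≤ 1 / 2) (L : Fin n × Fin m → ℝ)
    (i : Fin n) : 0 < groupMass (B.mix L) i :=
  Finset.sum_pos (fun j _ => (half_pos (hedge_pos B.η L (i, j))).trans_le
    (B.half_hedge_le_mix hρ L (i, j))) Finset.univ_nonempty

/-- One step of the analysis of exponential weights. -/
theorem ELP.sum_exp_update_le {B : ELP n m} (hη : 0 < B.η) (hlam : B.lam = B.η / 2)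
    (hρ : (B.ρ : ℝ) ≤ 1 / 2) (L : Fin n × Fin m → ℝ) {o : Fin n × (Fin m → ℝ)}
    (ho : ∀ j, o.2 j ∈ Set.Icc (0 : ℝ) 1) :
    ∑ a, Real.exp (-(B.η * B.update L o a)) ≤
      (∑ a, Real.exp (-(B.η * L a))) * Real.exp (-(B.η * (groupMean (B.mix L) o
        - B.ρ * ∑ a, B.s a * (B.update L o a - L a)
        - 5 / 2 * B.η * (1 / (groupMass (B.mix L) o.1 + B.η / 2))))) := by
  set η := B.η with hηd
  set w := B.mix L with hw
  set W := groupMass w o.1 with hWd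
  have hW : 0 < W := B.groupMass_mix_pos hρ L o.1
  set q := 1 / (W + η / 2) with hq
  have hq0 : 0 < q := by positivity
  set M := groupMean w o with hM
  have hMm : M ∈ Set.Icc (0 : ℝ) 1 := groupMean_mem hW ho
  let p := hedge η L
  have hc : ∀ a, B.update L o a = L a + if a.1 = o.1 then o.2 a.2 * q else 0 := by
    intro a
    simp only [ELP.update, hlam, hq, mul_one_div]
    rfl
  set c : Fin n × Fin m → ℝ := fun a => if a.1 = o.1 then o.2 a.2 * q else 0 with hcd
  have hc0 : ∀ a, 0 ≤ c a := by
    intro a; simp only [hcd]; split_ifs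
    · exact mul_nonneg (ho _).1 hq0.le
    · exact le_rfl
  set Zs := ∑ a, Real.exp (-(η * L a)) with hZ
  have hZ0 : 0 < Zs := Finset.sum_pos (fun b _ => Real.exp_pos _) Finset.univ_nonempty
  have hp : ∀ a, Real.exp (-(η * L a)) = Zs * p a := by
    intro a
    change _ = Zs * (Real.exp (-(η * L a)) / Zs)
    field_simp
  have hp1 : ∑ a, p a = 1 := p.2.2
  have hwc : ∑ a, w a * c a = M * (W * q) := by
    rw [sum_mul_ite_fst (fun a => w a) (fun j => o.2 j * q) o.1, hM, groupMean, Finset.sum_mul]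
    refine Finset.sum_congr rfl fun j _ => ?_
    rw [← hWd]; field_simp
  have hWq : W * q = 1 - η / 2 * q := by
    rw [hq]; field_simp; ring
  have hwc' : ∑ a, w a * c a = (1 - B.ρ) * ∑ a, p a * c a + B.ρ * ∑ a, B.s a * c a := by
    rw [Finset.mul_sum, Finset.mul_sum, ← Finset.sum_add_distrib]
    refine Finset.sum_congr rfl fun a _ => ?_
    change ((1 - (B.ρ : ℝ)) * p a + B.ρ * B.s a) * c a = _
    ring
  have hA0 : 0 ≤ ∑ a, p a * c a :=
    Finset.sum_nonneg fun a _ => mul_nonneg (p.2.1 a) (hc0 a)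
  -- The estimated cost under `w` is `M * (W * q)`, and `W * q` falls short of 1 by `η / 2 * q`, the
  -- bias of implicit exploration. Passing from `w` to the exponential weights `p` costs the
  -- explicit exploration term.
  have h1 : M ≤ ∑ a, p a * c a + B.ρ * ∑ a, B.s a * c a + η / 2 * q := by
    have hρ0 : 0 ≤ (B.ρ : ℝ) := B.ρ.2.1
    have h2 : M - η / 2 * q ≤ M * (W * q) := by
      rw [hWq]
      have : 0 < η / 2 * q := by positivity
      nlinarith [hMm.2]
    rw [← hwc, hwc'] at h2
    nlinarith
  -- Here `c ≤ q` on the observed group and `p ≤ 2 * w`, so the sum is at most `2 * q ^ 2 * W`. This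
  -- 2 and the bias `1 / 2` make up the constant `5 / 2`.
  have h2 : ∑ a, p a * c a ^ 2 ≤ 2 * q := by
    have e1 : ∀ a, c a ^ 2 = if a.1 = o.1 then (o.2 a.2 * q) ^ 2 else 0 := by
      intro a; simp only [hcd]; split_ifs <;> simp
    simp only [e1]
    rw [sum_mul_ite_fst (fun a => p a) (fun j => (o.2 j * q) ^ 2) o.1]
    calc ∑ j, p (o.1, j) * (o.2 j * q) ^ 2 ≤ ∑ j, w (o.1, j) * (2 * q ^ 2) := by
          refine Finset.sum_le_sum fun j _ => ?_
          have e2 : p (o.1, j) / 2 ≤ w (o.1, j) := B.half_hedge_le_mix hρ L (o.1, j)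
          have e3 : (o.2 j * q) ^ 2 ≤ q ^ 2 := by
            rw [mul_pow]
            exact mul_le_of_le_one_left (by positivity) (pow_le_one₀ (ho j).1 (ho j).2)
          have e4 : 0 ≤ p (o.1, j) := p.2.1 _
          calc p (o.1, j) * (o.2 j * q) ^ 2 ≤ p (o.1, j) * q ^ 2 := by gcongr
            _ = p (o.1, j) / 2 * (2 * q ^ 2) := by ring
            _ ≤ _ := by gcongr
      _ = 2 * q * (W * q) := by rw [← Finset.sum_mul, hWd, groupMass]; ring
      _ ≤ 2 * q := by
          rw [hWq]
          have : 0 < η / 2 * q := by positivity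
          nlinarith
  have hd : ∀ a, B.update L o a - L a = c a := fun a => by rw [hc a]; simp [hcd]
  simp only [hd]
  calc ∑ a, Real.exp (-(η * B.update L o a))
      ≤ ∑ a, Zs * (p a * (1 - η * c a + η ^ 2 * c a ^ 2)) := by
        refine Finset.sum_le_sum fun a _ => ?_
        rw [hc a, mul_add, neg_add, Real.exp_add, hp, mul_assoc]
        refine mul_le_mul_of_nonneg_left (mul_le_mul_of_nonneg_left ?_ (p.2.1 a)) hZ0.le
        refine (exp_neg_le_of_nonneg (mul_nonneg hη.le (hc0 a))).trans (le_of_eq ?_)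
        ring
    _ = Zs * (1 + (-(η * ∑ a, p a * c a) + η ^ 2 * ∑ a, p a * c a ^ 2)) := by
        rw [← Finset.mul_sum]
        have e : ∀ a, p a * (1 - η * c a + η ^ 2 * c a ^ 2) =
            p a + (-η) * (p a * c a) + η ^ 2 * (p a * c a ^ 2) := fun a => by ring
        simp only [e, Finset.sum_add_distrib, ← Finset.mul_sum, hp1]
        ring
    _ ≤ Zs * Real.exp (-(η * ∑ a, p a * c a) + η ^ 2 * ∑ a, p a * c a ^ 2) := by
        refine mul_le_mul_of_nonneg_left ?_ hZ0.le
        linarith [Real.add_one_le_exp (-(η * ∑ a, p a * c a) + η ^ 2 * ∑ a, p a * c a ^ 2)]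
    _ ≤ _ := by
        refine mul_le_mul_of_nonneg_left (Real.exp_le_exp.2 ?_) hZ0.le
        have e1 := mul_le_mul_of_nonneg_left h1 hη.le
        have e2 := mul_le_mul_of_nonneg_left h2 (sq_nonneg η)
        nlinarith

variable {E : Type*} [NormedAddCommGroup E] [NormedSpace ℝ E]

/-- The cumulative cost estimates of ELP after a history. -/
noncomputable def ELP.estimate (B : ELP n m) (xs : List (Feedback n m E)) : Fin n × Fin m → ℝ :=
  (observations xs).foldl B.update 0

/-- The distribution played by ELP after a history. -/
noncomputable def ELP.play (B : ELP n m) (xs : List (Feedback n m E)) : stdSimplex ℝ (Fin n × Fin m) :=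
  B.act (observations xs)

theorem ELP.estimate_cons (B : ELP n m) (x : Feedback n m E) (xs : List (Feedback n m E)) :
    B.estimate (x :: xs) = B.update (B.estimate xs) x.2 := by
  simp [ELP.estimate, List.foldl_append]

theorem ELP.groupMass_play_pos {B : ELP n m} (hρ : (B.ρ : ℝ) ≤ 1 / 2)
    (xs : List (Feedback n m E)) (i : Fin n) : 0 < groupMass (B.play xs) i :=
  B.groupMass_mix_pos hρ _ i

theorem ELP.estimate_eq_pathSum {B : ELP n m} (hlam : B.lam = B.η / 2) (a : Fin n × Fin m)
    (xs : List (Feedback n m E)) :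
    B.estimate xs a = pathSum (fun past x =>
      if a.1 = x.2.1 then x.2.2 a.2 / (groupMass (B.play past) x.2.1 + B.η / 2) else 0) xs := by
  induction xs with
  | nil => rfl
  | cons x xs ih =>
    rw [B.estimate_cons, pathSum_cons, ← ih, ELP.update, hlam]
    rfl

/-- The regret of ELP in terms of its cost estimates. -/
theorem ELP.pathSum_groupMean_le {B : ELP n m} (hη : 0 < B.η) (hlam : B.lam = B.η / 2)
    (hρ : (B.ρ : ℝ) ≤ 1 / 2) {xs : List (Feedback n m E)} (hxs : Bounded xs)
    (a : Fin n × Fin m) :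
    pathSum (fun past x => groupMean (B.play past) x.2) xs ≤
      B.estimate xs a + Real.log (m * n) / B.η
        + 5 / 2 * B.η * pathSum (fun past x => 1 / (groupMass (B.play past) x.2.1 + B.η / 2)) xs
        + B.ρ * ∑ b, B.s b * B.estimate xs b := by
  -- The total weight starts at the number `m * n` of meta-actions and the one-step bounds multiply;
  -- afterwards it is bounded below by the single weight of `a`.
  have key : ∑ b, Real.exp (-(B.η * B.estimate xs b)) ≤ (m * n) *
      Real.exp (-(B.η * (pathSum (fun past x => groupMean (B.play past) x.2) xs
        - B.ρ * ∑ b, B.s b * B.estimate xs b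
        - 5 / 2 * B.η *
          pathSum (fun past x => 1 / (groupMass (B.play past) x.2.1 + B.η / 2)) xs))) := by
    induction xs with
    | nil => simp [ELP.estimate, mul_comm]
    | cons x xs ih =>
      have h1 := ih fun y hy => hxs y (List.mem_cons_of_mem _ hy)
      have h2 := B.sum_exp_update_le hη hlam hρ (B.estimate xs) (hxs x List.mem_cons_self).2
      rw [B.estimate_cons]
      refine h2.trans ((mul_le_mul_of_nonneg_right h1 (Real.exp_pos _).le).trans (le_of_eq ?_))
      rw [mul_assoc, ← Real.exp_add]
      congr 2
      simp only [pathSum_cons, mul_sub, Finset.sum_sub_distrib]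
      change _ + -(_ * groupMean (B.play xs) x.2 - _ - _ * (_ *
        (1 / (groupMass (B.play xs) x.2.1 + B.η / 2)))) = _
      ring
  have h1 : Real.exp (-(B.η * B.estimate xs a)) ≤ ∑ b, Real.exp (-(B.η * B.estimate xs b)) :=
    Finset.single_le_sum (f := fun b => Real.exp (-(B.η * B.estimate xs b)))
      (fun b _ => (Real.exp_pos _).le) (Finset.mem_univ a)
  have hmn : (0 : ℝ) < m * n := by
    have h3 : (0 : ℝ) < m := Nat.cast_pos.2 (NeZero.pos m)
    have h4 : (0 : ℝ) < n := Nat.cast_pos.2 (NeZero.pos n)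
    positivity
  have h2 := Real.log_le_log (Real.exp_pos _) (h1.trans key)
  rw [Real.log_exp, Real.log_mul hmn.ne' (Real.exp_pos _).ne', Real.log_exp] at h2
  have h3 : B.η * (Real.log (m * n) / B.η) = Real.log (m * n) := by field_simp
  refine le_of_mul_le_mul_left ?_ hη
  linarith

end Auditor

/-! ### The supermartingale principle for the rounds -/

section Rounds

variable {n m : ℕ} [NeZero n] [NeZero m] {H Z α E : Type*} [NormedAddCommGroup E]
  [NormedSpace ℝ E] [MeasurableSpace E]

/-- What is learned in the round after the history `xs` if the learner's pair and datapoint are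
`a`, `z`, and the auditor's are `b`, `z'`. -/
def feedback {Θ : Set E} (h : E → H) (l : Fin m → H → Z → ℝ)
    (grad : Fin m → E → Z → (E →L[ℝ] ℝ)) (Q : OnlineLearner Θ) (xs : List (Feedback n m E))
    (a : Fin n × Fin m) (z : Z) (b : Fin n × Fin m) (z' : Z) : Feedback n m E :=
  (grad a.2 (Q.act (costs xs) : E) z, (b.1, fun j' => 1 - l j' (h (Q.act (costs xs) : E)) z'))

theorem callsExactly_rounds {Θ : Set E} (h : E → H) (l : Fin m → H → Z → ℝ)
    (grad : Fin m → E → Z → (E →L[ℝ] ℝ)) (Q : OnlineLearner Θ) (B : ELP n m)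
    (out : List (E →L[ℝ] ℝ) → α) (N : ℕ) :
    ∀ cs obs, (rounds h l grad Q B (fun cs => .done (out cs)) N cs obs).CallsExactly (2 * N) := by
  induction N with
  | zero => exact fun _ _ => rfl
  | succ N ih => exact fun cs obs a => ⟨2 * N + 1, rfl, fun z b => ⟨2 * N, rfl, fun z' => ih _ _⟩⟩

variable [MeasurableSpace Z]

/-- A supermartingale `V` along the rounds bounds the failure probability. -/
theorem ofReal_one_sub_le_prob_rounds {D : Fin n → Measure Z} [∀ i, IsProbabilityMeasure (D i)]
    {Θ : Set E} {h : E → H} {l : Fin m → H → Z → ℝ} {grad : Fin m → E → Z → (E →L[ℝ] ℝ)}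
    {Q : OnlineLearner Θ} {B : ELP n m} {out : List (E →L[ℝ] ℝ) → α} {S : Set α}
    {p : List (Feedback n m E) → Prop} {V : List (Feedback n m E) → ℝ} {M : ℕ}
    (hp : ∀ xs, p xs → ∀ a z b z', p (feedback h l grad Q xs a z b z' :: xs))
    (hV0 : ∀ xs, 0 ≤ V xs)
    (hstep : ∀ xs, p xs → ∃ (F G : Fin n × Fin m → Z → ℝ) (v v' : ℝ),
      MeanLE (B.play xs) (fun a => D a.1) F v ∧ MeanLE (B.play xs) (fun a => D a.1) G v' ∧
      v + v' ≤ V xs ∧ ∀ a z b z', V (feedback h l grad Q xs a z b z' :: xs) ≤ F a z + G b z')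
    (hfin : ∀ xs, p xs → xs.length = M → V xs < 1 → out (costs xs) ∈ S) (N : ℕ) :
    ∀ xs, p xs → xs.length + N = M → ENNReal.ofReal (1 - V xs) ≤
      (rounds h l grad Q B (fun cs => .done (out cs)) N (costs xs) (observations xs)).prob D S := by
  induction N with
  | zero => exact fun xs hxs hN => Prog.ofReal_one_sub_le_prob_done (hfin xs hxs hN) (hV0 xs)
  | succ N ih =>
    intro xs hxs hN
    obtain ⟨F, G, v, v', hF, hG, hv, hVle⟩ := hstep xs hxs
    have hw : ∑ a, B.play xs a = 1 := (B.play xs).2.2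
    -- The auditor's draw and datapoint come later and are independent of the learner's, so during
    -- the learner's half of the round their contribution is the constant `g`.
    set g := ∑ b, B.play xs b * ∫ z', G b z' ∂(D b.1) with hg
    have h1 : ENNReal.ofReal (1 - V xs) ≤ ENNReal.ofReal
        (1 - ∑ a, B.act (observations xs) a * ∫ z, (F a z + g) ∂(D a.1)) := by
      refine ENNReal.ofReal_le_ofReal (sub_le_sub_left ?_ 1)
      simp only [integral_add (hF.1 _) (integrable_const g), integral_const, probReal_univ,
        smul_eq_mul, one_mul, mul_add, Finset.sum_add_distrib, ← Finset.sum_mul]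
      change _ + (∑ a, B.play xs a) * g ≤ _
      rw [hw, one_mul]
      exact (add_le_add hF.2 hG.2).trans hv
    refine h1.trans (Prog.ofReal_one_sub_le_prob_draw fun a =>
      Prog.ofReal_one_sub_le_prob_call ((hF.1 a).add (integrable_const g)) fun z => ?_)
    have h2 : F a z + g =
        ∑ b, B.act (observations xs) b * ∫ z', (F a z + G b z') ∂(D b.1) := by
      simp only [integral_add (integrable_const (F a z)) (hG.1 _), integral_const, probReal_univ,
        smul_eq_mul, one_mul, mul_add, Finset.sum_add_distrib, ← Finset.sum_mul]
      change _ = (∑ a, B.play xs a) * _ + _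
      rw [hw, one_mul]
      rfl
    rw [h2]
    refine Prog.ofReal_one_sub_le_prob_draw fun b =>
      Prog.ofReal_one_sub_le_prob_call ((integrable_const _).add (hG.1 b)) fun z' => ?_
    refine (ENNReal.ofReal_le_ofReal (sub_le_sub_left (hVle a z b z') 1)).trans ?_
    have := ih (feedback h l grad Q xs a z b z' :: xs) (hp xs hxs a z b z')
      (by rw [List.length_cons]; omega)
    rwa [costs_cons, observations_cons] at this

end Rounds

/-! ### Risks of the hypotheses -/

section Risk

variable {m : ℕ} {H Z E : Type*} [NormedAddCommGroup E] [NormedSpace ℝ E] [MeasurableSpace E]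
  [MeasurableSpace Z] {Θ : Set E} {h : E → H} {l : Fin m → H → Z → ℝ}
  {grad : Fin m → E → Z → (E →L[ℝ] ℝ)}

theorem SmoothConvex.integrable_loss (hs : SmoothConvex Θ h l grad) (P : Measure Z)
    [IsProbabilityMeasure P] (j : Fin m) {θ : E} (hθ : θ ∈ Θ) : Integrable (l j (h θ)) P :=
  integrable_of_measurable_abs_le (hs.loss_measurable j θ hθ) (C := 1) fun z => by
    rw [abs_of_nonneg (hs.loss_mem j θ hθ z).1]; exact (hs.loss_mem j θ hθ z).2

theorem SmoothConvex.risk_mem (hs : SmoothConvex Θ h l grad) (P : Measure Z)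
    [IsProbabilityMeasure P] (j : Fin m) {θ : E} (hθ : θ ∈ Θ) :
    risk P (l j) (h θ) ∈ Set.Icc (0 : ℝ) 1 := by
  refine ⟨integral_nonneg fun z => (hs.loss_mem j θ hθ z).1, ?_⟩
  calc risk P (l j) (h θ) ≤ ∫ _, (1 : ℝ) ∂P :=
        integral_mono (hs.integrable_loss P j hθ) (integrable_const _)
          fun z => (hs.loss_mem j θ hθ z).2
    _ = 1 := by simp

theorem SmoothConvex.convexOn_risk (hs : SmoothConvex Θ h l grad) (P : Measure Z)
    [IsProbabilityMeasure P] (j : Fin m) : ConvexOn ℝ Θ (fun θ => risk P (l j) (h θ)) := by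
  refine ⟨hs.convex, fun x hx y hy a b ha hb hab => ?_⟩
  have hx' := hs.integrable_loss P j hx
  have hy' := hs.integrable_loss P j hy
  simp only [risk, smul_eq_mul]
  rw [← integral_const_mul, ← integral_const_mul,
    ← integral_add (hx'.const_mul a) (hy'.const_mul b)]
  exact integral_mono (hs.integrable_loss P j (hs.convex hx hy ha hb hab))
    ((hx'.const_mul a).add (hy'.const_mul b)) fun z => (hs.loss_convex j z).2 hx hy ha hb hab

variable {n : ℕ}

theorem risk_le_worstRisk (D : Fin n → Measure Z) (l : Fin m → H → Z → ℝ) (f : H)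
    (a : Fin n × Fin m) : risk (D a.1) (l a.2) f ≤ worstRisk D l f :=
  le_ciSup (f := fun p : Fin n × Fin m => risk (D p.1) (l p.2) f) (Set.finite_range _).bddAbove a

theorem SmoothConvex.worstRisk_nonneg (hs : SmoothConvex Θ h l grad) (D : Fin n → Measure Z)
    [∀ i, IsProbabilityMeasure (D i)] {θ : E} (hθ : θ ∈ Θ) : 0 ≤ worstRisk D l (h θ) :=
  Real.iSup_nonneg fun a => (hs.risk_mem (D a.1) a.2 hθ).1

theorem SmoothConvex.opt_nonneg (hs : SmoothConvex Θ h l grad) (D : Fin n → Measure Z)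
    [∀ i, IsProbabilityMeasure (D i)] : 0 ≤ opt D l (h '' Θ) := by
  refine le_csInf ((hs.nonempty.image h).image _) ?_
  rintro _ ⟨_, ⟨θ, hθ, rfl⟩, rfl⟩
  exact hs.worstRisk_nonneg D hθ

theorem SmoothConvex.worstRisk_le_one [NeZero n] [NeZero m] (hs : SmoothConvex Θ h l grad) (D : Fin n → Measure Z)
    [∀ i, IsProbabilityMeasure (D i)] {θ : E} (hθ : θ ∈ Θ) : worstRisk D l (h θ) ≤ 1 :=
  ciSup_le fun a => (hs.risk_mem (D a.1) a.2 hθ).2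

theorem SmoothConvex.exists_worstRisk_lt (hs : SmoothConvex Θ h l grad) (D : Fin n → Measure Z)
    {ζ : ℝ} (hζ : 0 < ζ) :
    ∃ u ∈ Θ, worstRisk D l (h u) < opt D l (h '' Θ) + ζ := by
  obtain ⟨_, ⟨_, ⟨u, hu, rfl⟩, rfl⟩, h1⟩ := exists_lt_of_csInf_lt
    ((hs.nonempty.image h).image (worstRisk D l)) (lt_add_of_pos_right (opt D l (h '' Θ)) hζ)
  exact ⟨u, hu, h1⟩

theorem SmoothConvex.bounded_feedback {Q : OnlineLearner Θ}
    (hs : SmoothConvex Θ h l grad) {xs : List (Feedback n m E)} (hxs : Bounded xs) (a : Fin n × Fin m) (z : Z)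
    (b : Fin n × Fin m) (z' : Z) : Bounded (feedback h l grad Q xs a z b z' :: xs) := by
  intro x hx
  rcases List.mem_cons.1 hx with rfl | hx
  · refine ⟨hs.grad_norm_le _ _ (Q.act (costs xs)).2 _, fun j => ?_⟩
    have := hs.loss_mem j _ (Q.act (costs xs)).2 z'
    exact ⟨sub_nonneg.2 this.2, sub_le_self _ this.1⟩
  · exact hxs x hx

end Risk

/-! ### The deviations and their supermartingale -/

section Potential

variable {n m : ℕ} {H Z : Type*} [MeasurableSpace Z]

/-- The mean risk of `f` over the pairs drawn from `w`. -/
noncomputable def meanRisk (D : Fin n → Measure Z) (l : Fin m → H → Z → ℝ)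
    (w : stdSimplex ℝ (Fin n × Fin m)) (f : H) : ℝ :=
  ∑ a, w a * risk (D a.1) (l a.2) f

theorem meanRisk_of_subsingleton [Subsingleton (Fin n × Fin m)] (D : Fin n → Measure Z)
    (l : Fin m → H → Z → ℝ) (w : stdSimplex ℝ (Fin n × Fin m)) (f : H) (a : Fin n × Fin m) :
    meanRisk D l w f = risk (D a.1) (l a.2) f := by
  have hw : ∑ b, w b = 1 := w.2.2
  rw [Fintype.sum_subsingleton _ a] at hw
  rw [meanRisk, Fintype.sum_subsingleton _ a, hw, one_mul]

variable [NeZero n] [NeZero m] {E : Type*} [NormedAddCommGroup E] [NormedSpace ℝ E]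
  [MeasurableSpace E]

/-- Log-deviation of the learner's linear costs from the mean risks. -/
noncomputable def learnerDev (D : Fin n → Measure Z) {Θ : Set E} (h : E → H)
    (l : Fin m → H → Z → ℝ) (Q : OnlineLearner Θ) (B : ELP n m) (u : E) :
    List (Feedback n m E) → ℝ :=
  pathSum fun past x =>
    B.η * (meanRisk D l (B.play past) (h (Q.act (costs past)))
      - meanRisk D l (B.play past) (h u) - x.1 ((Q.act (costs past) : E) - u)) - B.η ^ 2

/-- Log-deviation of the cost estimates of the meta-action `a`. -/
noncomputable def estimateDev (D : Fin n → Measure Z) {Θ : Set E} (h : E → H)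
    (l : Fin m → H → Z → ℝ) (Q : OnlineLearner Θ) (B : ELP n m) (a : Fin n × Fin m) :
    List (Feedback n m E) → ℝ :=
  pathSum fun past x =>
    B.η * ((if a.1 = x.2.1 then x.2.2 a.2 / (groupMass (B.play past) x.2.1 + B.η / 2) else 0)
      - (1 - risk (D a.1) (l a.2) (h (Q.act (costs past)))))

/-- Log-deviation of the inverse masses of the observed groups. -/
noncomputable def massDev (B : ELP n m) : List (Feedback n m E) → ℝ :=
  pathSum fun past x => B.η * (1 / (groupMass (B.play past) x.2.1 + B.η / 2) - n)

/-- Log-deviation of the conditional mean costs of the observed groups. -/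
noncomputable def meanDev (D : Fin n → Measure Z) {Θ : Set E} (h : E → H)
    (l : Fin m → H → Z → ℝ) (Q : OnlineLearner Θ) (B : ELP n m) :
    List (Feedback n m E) → ℝ :=
  pathSum fun past x =>
    B.η * (1 - meanRisk D l (B.play past) (h (Q.act (costs past)))
      - groupMean (B.play past) x.2) - B.η ^ 2

/-- The supermartingale that controls all deviations. -/
noncomputable def potential (D : Fin n → Measure Z) {Θ : Set E} (h : E → H)
    (l : Fin m → H → Z → ℝ) (Q : OnlineLearner Θ) (B : ELP n m) (u : E) (α β : ℝ)
    (xs : List (Feedback n m E)) : ℝ :=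
  α * Real.exp (learnerDev D h l Q B u xs) +
    β * (∑ a, Real.exp (estimateDev D h l Q B a xs) + Real.exp (massDev B xs)
      + Real.exp (meanDev D h l Q B xs))

variable {D : Fin n → Measure Z} [∀ i, IsProbabilityMeasure (D i)] {Θ : Set E} {h : E → H}
  {l : Fin m → H → Z → ℝ} {grad : Fin m → E → Z → (E →L[ℝ] ℝ)} {Q : OnlineLearner Θ}
  {B : ELP n m}

/-- The learner's deviation depends on the new round only through `(a, z)`, the auditor's only
through `(b, z')`, so the bound splits; each exponential is multiplied by a factor bounded by one of
conditional mean at most 1. -/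
theorem SmoothConvex.potential_step (hs : SmoothConvex Θ h l grad) (hη : 0 < B.η)
    (hη1 : B.η ≤ 1) (hρ : (B.ρ : ℝ) ≤ 1 / 2) {u : E} (hu : u ∈ Θ) {α β : ℝ} (hα : 0 ≤ α)
    (hβ : 0 ≤ β) (xs : List (Feedback n m E)) :
    ∃ (F G : Fin n × Fin m → Z → ℝ) (v v' : ℝ),
      MeanLE (B.play xs) (fun a => D a.1) F v ∧ MeanLE (B.play xs) (fun a => D a.1) G v' ∧
      v + v' ≤ potential D h l Q B u α β xs ∧
      ∀ a z b z', potential D h l Q B u α β (feedback h l grad Q xs a z b z' :: xs) ≤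
        F a z + G b z' := by
  have hθ : (Q.act (costs xs) : E) ∈ Θ := (Q.act (costs xs)).2
  set θ : E := ((Q.act (costs xs) : Θ) : E) with hθd
  set w := B.play xs with hw
  have hW : ∀ i, 0 < groupMass w i := B.groupMass_play_pos hρ xs
  have hmeas : ∀ j, Measurable (l j (h θ)) := fun j => hs.loss_measurable j θ hθ
  have hmem : ∀ j z, 1 - l j (h θ) z ∈ Set.Icc (0 : ℝ) 1 := fun j z =>
    ⟨sub_nonneg.2 (hs.loss_mem j θ hθ z).2, sub_le_self _ (hs.loss_mem j θ hθ z).1⟩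
  have hrisk : ∀ (a : Fin n × Fin m) (i : Fin n),
      ∫ z, (1 - l a.2 (h θ) z) ∂(D i) = 1 - risk (D i) (l a.2) (h θ) := by
    intro a i
    rw [integral_sub (integrable_const _) (hs.integrable_loss (D i) a.2 hθ)]
    simp [risk]
  -- the learner
  have H1 := meanLE_exp_sub_one w (fun a => D a.1) (η := B.η)
    (f := fun a z => l a.2 (h θ) z - l a.2 (h u) z)
    (fun a => (hmeas a.2).sub (hs.loss_measurable a.2 u hu))
    (fun a z => by
      have e1 := hs.loss_mem a.2 θ hθ z
      have e2 := hs.loss_mem a.2 u hu z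
      rw [abs_le]; constructor <;> linarith [e1.1, e1.2, e2.1, e2.2]) hη.le hη1
  have hgap : ∑ b, w b * ∫ y, (l b.2 (h θ) y - l b.2 (h u) y) ∂(D b.1) =
      meanRisk D l w (h θ) - meanRisk D l w (h u) := by
    simp only [meanRisk, ← Finset.sum_sub_distrib, ← mul_sub]
    refine Finset.sum_congr rfl fun b _ => ?_
    rw [integral_sub (hs.integrable_loss _ b.2 hθ) (hs.integrable_loss _ b.2 hu)]
    rfl
  rw [hgap] at H1
  -- the auditor
  have H2 := fun a : Fin n × Fin m => meanLE_exp_estimate_one w hW D a.1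
    ((hmeas a.2).const_sub 1) (hmem a.2) hη
  simp only [hrisk] at H2
  have H3 := meanLE_exp_inv_groupMass_one w hW D hη
  have H4 := meanLE_exp_sub_one w (fun a => D a.1) (η := B.η)
    (f := fun b z => groupMean w (b.1, fun j' => 1 - l j' (h θ) z))
    (fun b => Finset.measurable_fun_sum _ fun j _ =>
      show Measurable fun z => w (b.1, j) / groupMass w b.1 * (1 - l j (h θ) z) from
        ((hmeas j).const_sub 1).const_mul _)
    (fun b z => by
      have := groupMean_mem (o := (b.1, fun j' => 1 - l j' (h θ) z)) (hW b.1) fun j => hmem j z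
      rw [abs_of_nonneg this.1]; exact this.2) hη.le hη1
  have hmean : ∑ b, w b * ∫ y, groupMean w (b.1, fun j' => 1 - l j' (h θ) y) ∂(D b.1) =
      1 - meanRisk D l w (h θ) := by
    rw [sum_mul_fst w fun i => ∫ y, groupMean w (i, fun j' => 1 - l j' (h θ) y) ∂(D i)]
    have hw1 : ∑ a, w a = 1 := w.2.2
    have : 1 - meanRisk D l w (h θ) = ∑ a, w a * (1 - risk (D a.1) (l a.2) (h θ)) := by
      simp only [meanRisk, mul_sub, mul_one, Finset.sum_sub_distrib, hw1]
    rw [this, Fintype.sum_prod_type]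
    refine Finset.sum_congr rfl fun i _ => ?_
    simp only [groupMean]
    have hint : ∀ j, Integrable (fun y => 1 - l j (h θ) y) (D i) := fun j =>
      (integrable_const 1).sub (hs.integrable_loss (D i) j hθ)
    rw [integral_finsetSum _ fun j _ => (hint j).const_mul _, Finset.mul_sum]
    refine Finset.sum_congr rfl fun j _ => ?_
    rw [integral_const_mul, hrisk (i, j) i]
    have := (hW i).ne'
    field_simp
  rw [hmean] at H4
  refine ⟨_, _, _, _,
    (H1.const_mul (Real.exp_pos (learnerDev D h l Q B u xs)).le).const_mul hα,
    (((MeanLE.sum fun a => (H2 a).const_mul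
        (Real.exp_pos (estimateDev D h l Q B a xs)).le).add
      (H3.const_mul (Real.exp_pos (massDev B xs)).le)).add
      (H4.const_mul (Real.exp_pos (meanDev D h l Q B xs)).le)).const_mul hβ, ?_, ?_⟩
  · simp only [mul_one, potential]; exact le_rfl
  · intro a z b z'
    simp only [potential]
    -- For the learner, convexity replaces the linear cost by the loss difference to which `H1`
    -- applies; the auditor's increments match exactly.
    refine add_le_add ?_ (le_of_eq ?_)
    · rw [← Real.exp_add]
      refine mul_le_mul_of_nonneg_left (Real.exp_le_exp.2 ?_) hα
      rw [learnerDev, pathSum_cons]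
      refine add_le_add le_rfl (sub_le_sub_right (mul_le_mul_of_nonneg_left ?_ hη.le) _)
      exact sub_le_sub_left
        (sub_le_gradient (hs.loss_convex a.2 z) hθ hu (hs.hasGrad a.2 θ hθ z)) _
    · congr 1
      simp only [← Real.exp_add]
      rfl

end Potential

/-! ### The averaged parameter -/

section Output

variable {n m : ℕ} {H Z E : Type*} [NormedAddCommGroup E]
  [NormedSpace ℝ E] [MeasurableSpace E] [MeasurableSpace Z]
  {D : Fin n → Measure Z} [∀ i, IsProbabilityMeasure (D i)] {Θ : Set E} {h : E → H}
  {l : Fin m → H → Z → ℝ} {grad : Fin m → E → Z → (E →L[ℝ] ℝ)} {Q : OnlineLearner Θ}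

/-- The parameter returned by the algorithm with `T` iterations. -/
noncomputable def output {Θ : Set E} (Q : OnlineLearner Θ) (T : ℕ) (cs : List (E →L[ℝ] ℝ)) : E :=
  (T : ℝ)⁻¹ • ∑ t ∈ Finset.range T, (Q.act (cs.take t) : E)

theorem output_mem (hΘ : Convex ℝ Θ) {T : ℕ} (hT : 1 ≤ T) (cs : List (E →L[ℝ] ℝ)) :
    output Q T cs ∈ Θ := by
  have hT0 : (T : ℝ) ≠ 0 := by positivity
  rw [output, Finset.smul_sum]
  exact hΘ.sum_mem (fun _ _ => by positivity) (by simp [hT0]) fun t _ => (Q.act (cs.take t)).2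

/-- Jensen's inequality. The last action depends on all of `xs` and has no feedback, hence stands
outside the path sum. -/
theorem SmoothConvex.risk_output_le (hs : SmoothConvex Θ h l grad) (xs : List (Feedback n m E))
    (a : Fin n × Fin m) :
    (xs.length + 1) * risk (D a.1) (l a.2) (h (output Q (xs.length + 1) (costs xs))) ≤
      pathSum (fun past _ => risk (D a.1) (l a.2) (h (Q.act (costs past)))) xs
        + risk (D a.1) (l a.2) (h (Q.act (costs xs))) := by
  have hT0 : (0 : ℝ) < ((xs.length + 1 : ℕ) : ℝ) := by positivity
  have h1 := (hs.convexOn_risk (D a.1) a.2).map_sum_le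
    (t := Finset.range (xs.length + 1)) (w := fun _ => (((xs.length + 1 : ℕ) : ℝ))⁻¹)
    (p := fun t => ((Q.act ((costs xs).take t) : Θ) : E)) (fun _ _ => by positivity)
    (by simp only [Finset.sum_const, Finset.card_range, nsmul_eq_mul]
        exact mul_inv_cancel₀ hT0.ne')
    fun t _ => (Q.act ((costs xs).take t)).2
  rw [← Finset.smul_sum, ← Finset.smul_sum, Finset.sum_range_succ
    (fun t => risk (D a.1) (l a.2) (h (Q.act ((costs xs).take t))))] at h1
  rw [sum_range_take_costs (fun cs => risk (D a.1) (l a.2) (h (Q.act cs))),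
    List.take_of_length_le (by simp), smul_eq_mul, inv_mul_eq_div, le_div_iff₀ hT0] at h1
  push_cast at h1
  rw [mul_comm]
  simpa [output] using h1

end Output

/-! ### Regret of both players when the deviations are small -/

section Deterministic

variable {n m : ℕ} [NeZero n] [NeZero m] {H Z E : Type*} [NormedAddCommGroup E]
  [NormedSpace ℝ E] [MeasurableSpace E] [MeasurableSpace Z]
  {D : Fin n → Measure Z} [∀ i, IsProbabilityMeasure (D i)] {Θ : Set E} {h : E → H}
  {l : Fin m → H → Z → ℝ} {grad : Fin m → E → Z → (E →L[ℝ] ℝ)} {Q : OnlineLearner Θ}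
  {B : ELP n m}

/-- The regret of the auditor when its deviations are small. -/
theorem SmoothConvex.pathSum_risk_le (hs : SmoothConvex Θ h l grad) (hη : 0 < B.η)
    (hlam : B.lam = B.η / 2) (hρ : (B.ρ : ℝ) ≤ 1 / 2) (hρη : (B.ρ : ℝ) ≤ n * B.η)
    (hnη : n * B.η ≤ 1) {xs : List (Feedback n m E)} (hxs : Bounded xs) {T : ℝ}
    (hT : xs.length ≤ T) (hlog : Real.log (m * n) ≤ B.η * (n * B.η * T))
    (h1 : ∀ a, estimateDev D h l Q B a xs ≤ B.η * (3 * (n * B.η * T)))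
    (h2 : massDev B xs ≤ B.η * (3 * (n * B.η * T)))
    (h3 : meanDev D h l Q B xs ≤ B.η * (3 * (n * B.η * T))) (a : Fin n × Fin m) :
    pathSum (fun past _ => risk (D a.1) (l a.2) (h (Q.act (costs past)))) xs ≤
      pathSum (fun past _ => meanRisk D l (B.play past) (h (Q.act (costs past)))) xs
        + 22 * (n * B.η * T) := by
  set η := B.η with hηd
  set G := n * η * T with hG
  set N : ℝ := (xs.length : ℝ) with hN
  have hN0 : 0 ≤ N := Nat.cast_nonneg _
  have hn : (1 : ℝ) ≤ n := by exact_mod_cast NeZero.one_le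
  have hη1 : η ≤ 1 := by nlinarith
  have hT0 : 0 ≤ T := hN0.trans hT
  have hG0 : 0 ≤ G := by positivity
  have hnN : n * η * N ≤ G := by rw [hG]; gcongr
  have hηN : η * N ≤ G := by nlinarith [mul_nonneg hη.le hN0]
  have hL : ∀ b, B.estimate xs b ≤
      N - pathSum (fun past _ => risk (D b.1) (l b.2) (h (Q.act (costs past)))) xs + 3 * G := by
    intro b
    have h4 := h1 b
    simp only [estimateDev] at h4
    rw [pathSum_mul_left, pathSum_sub, ← B.estimate_eq_pathSum hlam, pathSum_sub, pathSum_const,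
      mul_one] at h4
    linarith [le_of_mul_le_mul_left h4 hη]
  have hLN : ∀ b, B.estimate xs b ≤ N + 3 * G := by
    intro b
    have h5 : pathSum (fun past (_ : Feedback n m E) =>
        (-1) * risk (D b.1) (l b.2) (h (Q.act (costs past)))) xs ≤ xs.length * 0 :=
      pathSum_le_length_mul (fun past _ => by
        linarith [(hs.risk_mem (D b.1) b.2 (Q.act (costs past)).2).1]) xs
    rw [pathSum_mul_left] at h5
    linarith [hL b]
  have hsL : ∑ b, B.s b * B.estimate xs b ≤ N + 3 * G := by
    have hs1 : ∑ b, B.s b = 1 := B.s.2.2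
    calc _ ≤ ∑ b, B.s b * (N + 3 * G) :=
          Finset.sum_le_sum fun b _ => mul_le_mul_of_nonneg_left (hLN b) (B.s.2.1 b)
      _ = _ := by rw [← Finset.sum_mul, hs1, one_mul]
  have hρs : B.ρ * ∑ b, B.s b * B.estimate xs b ≤ 4 * G := by
    have hρ0 : 0 ≤ (B.ρ : ℝ) := B.ρ.2.1
    calc _ ≤ B.ρ * (N + 3 * G) := mul_le_mul_of_nonneg_left hsL hρ0
      _ ≤ n * η * (N + 3 * G) := by gcongr
      _ ≤ 4 * G := by nlinarith
  have hm : 5 / 2 * η * pathSum (fun past (x : Feedback n m E) =>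
      1 / (groupMass (B.play past) x.2.1 + η / 2)) xs ≤ 10 * G := by
    simp only [massDev] at h2
    rw [pathSum_mul_left, pathSum_sub, pathSum_const] at h2
    have h6 := le_of_mul_le_mul_left h2 hη
    have h7 := mul_le_mul_of_nonneg_left h6 hη.le
    nlinarith [mul_le_mul_of_nonneg_right hη1 hG0]
  have hmean : N - pathSum (fun past (_ : Feedback n m E) =>
        meanRisk D l (B.play past) (h (Q.act (costs past)))) xs ≤
      pathSum (fun past x => groupMean (B.play past) x.2) xs + 4 * G := by
    simp only [meanDev] at h3
    rw [pathSum_sub, pathSum_mul_left, pathSum_sub, pathSum_sub, pathSum_const,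
      pathSum_const] at h3
    have h8 : η * (N - pathSum (fun past (_ : Feedback n m E) =>
        meanRisk D l (B.play past) (h (Q.act (costs past)))) xs -
      pathSum (fun past x => groupMean (B.play past) x.2) xs) ≤ η * (η * N + 3 * G) := by
      linarith
    linarith [le_of_mul_le_mul_left h8 hη]
  have hlog' : Real.log (m * n) / η ≤ G := by
    rw [div_le_iff₀ hη]; linarith
  -- In units of `G`, 22 is 3 for the estimate of `a`, 1 for `log (m * n) / η`, 10 for the inverse
  -- masses, 4 for explicit exploration and 4 for the group means.
  have h9 := B.pathSum_groupMean_le hη hlam hρ hxs a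
  linarith [hL a]

/-- The regret of the learner, including the last action, when its deviation is small. -/
theorem SmoothConvex.pathSum_meanRisk_le (hs : SmoothConvex Θ h l grad) (hη : 0 < B.η) {g : ℝ}
    {xs : List (Feedback n m E)} (hxs : Bounded xs)
    (hg : Q.HasRegretGuarantee (xs.length + 1) g) {u : E} (hu : u ∈ Θ) {K : ℝ}
    (h1 : learnerDev D h l Q B u xs ≤ B.η * K) :
    pathSum (fun past _ => meanRisk D l (B.play past) (h (Q.act (costs past)))) xs
        + meanRisk D l (B.play xs) (h (Q.act (costs xs))) ≤
      (xs.length + 1) * worstRisk D l (h u) + √(g * (xs.length + 1)) + B.η * xs.length + K := by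
  set θ : E := ((Q.act (costs xs) : Θ) : E) with hθd
  have hθ : θ ∈ Θ := (Q.act (costs xs)).2
  have hu1 : ∀ w : stdSimplex ℝ (Fin n × Fin m), meanRisk D l w (h u) ≤ worstRisk D l (h u) := by
    intro w
    have hw : ∑ a, w a = 1 := w.2.2
    calc _ ≤ ∑ a, w a * worstRisk D l (h u) := Finset.sum_le_sum fun a _ =>
          mul_le_mul_of_nonneg_left (risk_le_worstRisk D l (h u) a) (w.2.1 a)
      _ = _ := by rw [← Finset.sum_mul, hw, one_mul]
  obtain ⟨a, ha⟩ : ∃ a : Fin n × Fin m, meanRisk D l (B.play xs) (h θ) -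
      meanRisk D l (B.play xs) (h u) ≤
        risk (D a.1) (l a.2) (h θ) - risk (D a.1) (l a.2) (h u) := by
    set w := B.play xs
    obtain ⟨a, -, ha⟩ := Finset.exists_max_image (Finset.univ : Finset (Fin n × Fin m))
      (fun a => risk (D a.1) (l a.2) (h θ) - risk (D a.1) (l a.2) (h u)) Finset.univ_nonempty
    refine ⟨a, ?_⟩
    have hw : ∑ a, w a = 1 := w.2.2
    calc _ = ∑ b, w b * (risk (D b.1) (l b.2) (h θ) - risk (D b.1) (l b.2) (h u)) := by
          simp only [meanRisk, mul_sub, Finset.sum_sub_distrib]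
      _ ≤ ∑ b, w b * (risk (D a.1) (l a.2) (h θ) - risk (D a.1) (l a.2) (h u)) :=
          Finset.sum_le_sum fun b hb => mul_le_mul_of_nonneg_left (ha b hb) (w.2.1 b)
      _ = _ := by rw [← Finset.sum_mul, hw, one_mul]
  have hθi := hs.integrable_loss (D a.1) a.2 hθ
  have hui := hs.integrable_loss (D a.1) a.2 hu
  -- Some datapoint has a loss gap at least the mean gap at the pair `a`, so its gradient bounds the
  -- gap of the last action.
  obtain ⟨z, hz⟩ := exists_integral_le (hθi.sub hui)
  have hlast : meanRisk D l (B.play xs) (h θ) - meanRisk D l (B.play xs) (h u) ≤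
      grad a.2 θ z (θ - u) := by
    refine ha.trans (le_trans ?_
      (sub_le_gradient (hs.loss_convex a.2 z) hθ hu (hs.hasGrad a.2 θ hθ z)))
    refine le_trans (le_of_eq ?_) hz
    simp only [Pi.sub_apply]
    rw [integral_sub hθi hui]
    rfl
  -- The guarantee covers every sequence of `T` costs, so the history may be extended by the
  -- fictitious gradient at `a`, `z`; the auditor's entry is a dummy.
  have hreg := OnlineLearner.HasRegretGuarantee.pathSum_le hs.isCompact
    (xs := (grad a.2 θ z, ((0 : Fin n), fun _ => 0)) :: xs) hg
    (fun x hx => by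
      rcases List.mem_cons.1 hx with rfl | hx
      · exact hs.grad_norm_le _ _ hθ _
      · exact (hxs x hx).1) hu
  simp only [pathSum_cons, List.length_cons] at hreg
  rw [← hθd] at hreg
  push_cast at hreg
  have h2 : pathSum (fun past (_ : Feedback n m E) => meanRisk D l (B.play past) (h u)) xs ≤
      xs.length * worstRisk D l (h u) := pathSum_le_length_mul (fun past _ => hu1 _) xs
  simp only [learnerDev] at h1
  rw [pathSum_sub, pathSum_mul_left, pathSum_sub, pathSum_sub, pathSum_const] at h1
  have h3 : B.η * (pathSum (fun past (_ : Feedback n m E) =>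
      meanRisk D l (B.play past) (h (Q.act (costs past)))) xs
      - pathSum (fun past (_ : Feedback n m E) => meanRisk D l (B.play past) (h u)) xs
      - pathSum (fun past x => x.1 ((Q.act (costs past) : E) - u)) xs) ≤
      B.η * (B.η * xs.length + K) := by linarith
  have h4 := le_of_mul_le_mul_left h3 hη
  have h5 := hu1 (B.play xs)
  linarith

end Deterministic

/-! ### Assembling the high-probability bound -/

section Main

variable {n m : ℕ} [NeZero n] [NeZero m] {H Z E : Type*} [NormedAddCommGroup E]
  [NormedSpace ℝ E] [MeasurableSpace E] [MeasurableSpace Z]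
  {D : Fin n → Measure Z} [∀ i, IsProbabilityMeasure (D i)] {Θ : Set E} {h : E → H}
  {l : Fin m → H → Z → ℝ} {grad : Fin m → E → Z → (E →L[ℝ] ℝ)} {Q : OnlineLearner Θ}
  {B : ELP n m}

/-- The worst risk of the output if the learner's deviation is small and the auditor has small
regret. -/
theorem SmoothConvex.worstRisk_output_le (hs : SmoothConvex Θ h l grad) (hη : 0 < B.η) {g : ℝ}
    {xs : List (Feedback n m E)} (hxs : Bounded xs)
    (hg : Q.HasRegretGuarantee (xs.length + 1) g) {u : E} (hu : u ∈ Θ) {T : ℝ}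
    (hT : T = xs.length + 1)
    (h1 : learnerDev D h l Q B u xs ≤ B.η * (3 * (n * B.η * T)))
    (h2 : ∀ a : Fin n × Fin m,
      pathSum (fun past _ => risk (D a.1) (l a.2) (h (Q.act (costs past)))) xs
        + risk (D a.1) (l a.2) (h (Q.act (costs xs))) ≤
      pathSum (fun past _ => meanRisk D l (B.play past) (h (Q.act (costs past)))) xs
        + meanRisk D l (B.play xs) (h (Q.act (costs xs))) + 24 * (n * B.η * T)) :
    worstRisk D l (h (output Q (xs.length + 1) (costs xs))) ≤
      worstRisk D l (h u) + √(g / T) + 28 * (n * B.η) := by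
  have hT0 : 0 < T := by rw [hT]; positivity
  have h3 := hs.pathSum_meanRisk_le hη hxs hg hu h1
  rw [← hT] at h3
  have hsq : √(g * T) = T * √(g / T) := by
    rw [← Real.sqrt_sq hT0.le, ← Real.sqrt_mul (sq_nonneg _), Real.sqrt_sq hT0.le]
    congr 1
    field_simp
  have hn : (1 : ℝ) ≤ n := by exact_mod_cast NeZero.one_le
  have h4 : B.η * xs.length ≤ n * B.η * T := by
    have : B.η * xs.length ≤ B.η * T := by
      refine mul_le_mul_of_nonneg_left ?_ hη.le
      linarith
    nlinarith [mul_pos hη hT0]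
  refine ciSup_le fun a => ?_
  have h5 := hs.risk_output_le (D := D) (Q := Q) xs a
  rw [← hT] at h5
  refine le_of_mul_le_mul_left ?_ hT0
  rw [hsq] at h3
  -- 28 is 24 from the auditor, 3 from the learner's deviation and 1 from its compensator `η *
  -- xs.length`.
  linarith [h2 a]

theorem le_of_mul_exp_lt_one {α s K : ℝ} (hα : 0 < α) (hK : -Real.log α ≤ K)
    (hs : α * Real.exp s < 1) : s ≤ K := by
  have h1 := Real.log_lt_log (mul_pos hα (Real.exp_pos s)) hs
  rw [Real.log_mul hα.ne' (Real.exp_pos s).ne', Real.log_exp, Real.log_one] at h1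
  linarith

/-- The regret of the auditor including the last action; trivial for a single meta-action, otherwise
on the event that the auditor's deviations are small. -/
theorem SmoothConvex.auditor_le (hs : SmoothConvex Θ h l grad) (hη : 0 < B.η)
    (hlam : B.lam = B.η / 2) (hρ : (B.ρ : ℝ) ≤ 1 / 2) (hρη : (B.ρ : ℝ) ≤ n * B.η)
    (hnη : n * B.η ≤ 1) {xs : List (Feedback n m E)} (hxs : Bounded xs) {T : ℝ}
    (hT : T = xs.length + 1) (hlog : Real.log (m * n) ≤ B.η * (n * B.η * T)) (hmn : 2 ≤ m * n)
    (h1 : ∀ a, estimateDev D h l Q B a xs ≤ B.η * (3 * (n * B.η * T)))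
    (h2 : massDev B xs ≤ B.η * (3 * (n * B.η * T)))
    (h3 : meanDev D h l Q B xs ≤ B.η * (3 * (n * B.η * T))) (a : Fin n × Fin m) :
    pathSum (fun past _ => risk (D a.1) (l a.2) (h (Q.act (costs past)))) xs
        + risk (D a.1) (l a.2) (h (Q.act (costs xs))) ≤
      pathSum (fun past _ => meanRisk D l (B.play past) (h (Q.act (costs past)))) xs
        + meanRisk D l (B.play xs) (h (Q.act (costs xs))) + 24 * (n * B.η * T) := by
  have h4 := hs.pathSum_risk_le hη hlam hρ hρη hnη hxs (T := T) (by rw [hT]; linarith) hlog h1 h2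
    h3 a
  have h5 := (hs.risk_mem (D a.1) a.2 (Q.act (costs xs)).2).2
  have h6 : 0 ≤ meanRisk D l (B.play xs) (h (Q.act (costs xs))) :=
    Finset.sum_nonneg fun b _ =>
      mul_nonneg ((B.play xs).2.1 b) (hs.risk_mem (D b.1) b.2 (Q.act (costs xs)).2).1
  -- With at least two meta-actions, `log (m * n) ≥ 1 / 2`, so the last round's cost of at most 1 is
  -- absorbed, raising 22 to 24.
  have h7 : 1 ≤ 2 * (n * B.η * T) := by
    have hl2 : (1 : ℝ) / 2 ≤ Real.log 2 := by linarith [Real.log_two_gt_d9]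
    have hl : Real.log 2 ≤ Real.log (m * n) :=
      Real.log_le_log (by norm_num) (by exact_mod_cast hmn)
    have hn : (1 : ℝ) ≤ n := by exact_mod_cast NeZero.one_le
    have hη1 : B.η ≤ 1 := by nlinarith
    have hT0 : 0 < T := by rw [hT]; positivity
    have : 0 ≤ n * B.η * T := by positivity
    nlinarith
  linarith

theorem SmoothConvex.prob_algorithm_ge (hs : SmoothConvex Θ h l grad) {T : ℕ} (hT : 1 ≤ T)
    {g : ℝ} (hg : Q.HasRegretGuarantee T g) {δ : ℝ} (hδ : 0 < δ) (hδ1 : δ < 1) (hη : 0 < B.η)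
    (hηsq : B.η * (n * B.η * T) = Real.log (m * n / δ)) (hlam : B.lam = B.η / 2)
    (hρ : (B.ρ : ℝ) ≤ 1 / 2) (hρη : (B.ρ : ℝ) ≤ n * B.η) {ε : ℝ}
    (hε : √(g / T) + 29 * (n * B.η) ≤ ε) :
    ENNReal.ofReal (1 - δ) ≤ (algorithm h l grad Q B T).prob D
      {θ | θ ∈ Θ ∧ IsEpsOptimal D l (h '' Θ) ε (h θ)} := by
  have hn : (1 : ℝ) ≤ n := by exact_mod_cast NeZero.one_le
  have hm : (1 : ℝ) ≤ m := by exact_mod_cast NeZero.one_le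
  have hmn0 : (0 : ℝ) < m * n := by positivity
  have hη2 : 0 < n * B.η := by positivity
  -- If `n * η > 1` then `ε > 1` and every parameter in `Θ` is good, so the zero potential suffices.
  rcases lt_or_ge 1 (n * B.η) with hbig | hsmall
  · have h1 : ENNReal.ofReal (1 - 0) ≤ _ :=
      ofReal_one_sub_le_prob_rounds (D := D) (B := B) (h := h) (l := l) (grad := grad) (Q := Q)
        (out := output Q T) (p := fun _ => True) (V := fun _ => 0) (M := T - 1)
        (S := {θ | θ ∈ Θ ∧ IsEpsOptimal D l (h '' Θ) ε (h θ)})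
        (fun _ _ _ _ _ _ => trivial) (fun _ => le_rfl)
        (fun xs _ => ⟨fun _ _ => 0, fun _ _ => 0, 0, 0, by simp [MeanLE], by simp [MeanLE],
          by simp, by simp⟩)
        (fun xs _ _ _ => by
          refine ⟨output_mem hs.convex hT _, ?_⟩
          have h2 := hs.worstRisk_le_one D (output_mem (Q := Q) hs.convex hT (costs xs))
          have h3 := hs.opt_nonneg D
          have h4 : 0 ≤ √(g / T) := Real.sqrt_nonneg _
          rw [IsEpsOptimal]
          linarith) (T - 1) [] trivial (by simp)
    exact (ENNReal.ofReal_le_ofReal (by linarith)).trans h1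
  -- An approximate minimizer avoids showing that the infimum is attained; its slack `n * η` turns
  -- 28 into 29.
  obtain ⟨u, hu, hopt⟩ := hs.exists_worstRisk_lt D hη2
  have hη1 : B.η ≤ 1 := by nlinarith
  -- one run of the supermartingale argument for given weights of the failure events
  have main : ∀ α β : ℝ, 0 < α → 0 ≤ β → α + β * (n * m + 2) ≤ δ →
      -Real.log α ≤ B.η * (3 * (n * B.η * T)) →
      (∀ xs : List (Feedback n m E), Bounded xs → xs.length = T - 1 →
        potential D h l Q B u α β xs < 1 → ∀ a : Fin n × Fin m,
        pathSum (fun past _ => risk (D a.1) (l a.2) (h (Q.act (costs past)))) xs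
          + risk (D a.1) (l a.2) (h (Q.act (costs xs))) ≤
        pathSum (fun past _ => meanRisk D l (B.play past) (h (Q.act (costs past)))) xs
          + meanRisk D l (B.play xs) (h (Q.act (costs xs))) + 24 * (n * B.η * T)) →
      ENNReal.ofReal (1 - δ) ≤ (algorithm h l grad Q B T).prob D
        {θ | θ ∈ Θ ∧ IsEpsOptimal D l (h '' Θ) ε (h θ)} := by
    intro α β hα hβ hαβ hlogα haud
    have hV0 : ∀ xs, 0 ≤ potential D h l Q B u α β xs := fun xs => by
      have := hα.le
      unfold potential
      positivity
    have h1 := ofReal_one_sub_le_prob_rounds (D := D) (B := B) (h := h) (l := l) (grad := grad)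
      (Q := Q) (out := output Q T) (p := Bounded) (V := potential D h l Q B u α β) (M := T - 1)
      (S := {θ | θ ∈ Θ ∧ IsEpsOptimal D l (h '' Θ) ε (h θ)})
      (fun xs hxs a z b z' => hs.bounded_feedback hxs a z b z') hV0
      (fun xs _ => hs.potential_step hη hη1 hρ hu hα.le hβ xs)
      (fun xs hxs hlen hV => by
        refine ⟨output_mem hs.convex hT _, ?_⟩
        have hlen' : xs.length + 1 = T := by omega
        have hTr : (T : ℝ) = xs.length + 1 := by rw [← hlen']; push_cast; rfl
        have h2 : α * Real.exp (learnerDev D h l Q B u xs) < 1 := by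
          refine lt_of_le_of_lt ?_ hV
          unfold potential
          have : 0 ≤ β * (∑ a, Real.exp (estimateDev D h l Q B a xs) + Real.exp (massDev B xs)
            + Real.exp (meanDev D h l Q B xs)) :=
            mul_nonneg hβ (add_nonneg (add_nonneg (Finset.sum_nonneg fun _ _ =>
              (Real.exp_pos _).le) (Real.exp_pos _).le) (Real.exp_pos _).le)
          linarith
        have h3 := hs.worstRisk_output_le hη hxs (by rw [hlen']; exact hg) hu hTr
          (le_of_mul_exp_lt_one hα hlogα h2) (haud xs hxs hlen hV)
        rw [hlen'] at h3
        rw [IsEpsOptimal]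
        linarith) (T - 1) [] (fun x hx => by simp at hx) (by simp)
    refine le_trans (ENNReal.ofReal_le_ofReal (sub_le_sub_left ?_ 1)) h1
    refine le_trans (le_of_eq ?_) hαβ
    simp only [potential, learnerDev, estimateDev, massDev, meanDev, pathSum_nil, Real.exp_zero,
      Finset.sum_const, Finset.card_univ, Fintype.card_prod, Fintype.card_fin, nsmul_eq_mul]
    push_cast
    ring
  have hLpos : 0 < B.η * (n * B.η * T) := by positivity
  -- For a single meta-action `log (1 / δ)` may be arbitrarily small and cannot absorb the last
  -- round. But then mean risk equals risk, the auditor has no regret, and all of `δ` goes to the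
  -- learner (`β = 0`).
  rcases Nat.lt_or_ge (m * n) 2 with hmn | hmn
  · have hm1 : m * n = 1 := by
      have : 0 < m * n := Nat.mul_pos (NeZero.pos m) (NeZero.pos n)
      omega
    have hsub : Subsingleton (Fin n × Fin m) :=
      Fintype.card_le_one_iff_subsingleton.1
        (by rw [Fintype.card_prod, Fintype.card_fin, Fintype.card_fin, mul_comm, hm1])
    have hm1' : (m : ℝ) * n = 1 := by exact_mod_cast hm1
    rw [hm1', one_div, Real.log_inv] at hηsq
    refine main δ 0 hδ le_rfl (by rw [zero_mul, add_zero]) (by linarith) fun xs _ _ _ a => ?_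
    simp only [meanRisk_of_subsingleton D l _ _ a]
    have : 0 ≤ n * B.η * T := by positivity
    linarith
  · have hmn' : (2 : ℝ) ≤ m * n := by exact_mod_cast hmn
    set k : ℝ := m * n with hk
    -- Equal shares for the `k + 3` failure events: the learner, `k` cost estimates, the inverse
    -- masses and the group means.
    have hα : 0 < δ / (k + 3) := by positivity
    -- The threshold factor 3 comes from `(k + 3) / δ ≤ (k / δ) ^ 3`, valid for `k ≥ 2` and `δ < 1`.
    have hlog : -Real.log (δ / (k + 3)) ≤ B.η * (3 * (n * B.η * T)) := by
      have e1 : B.η * (3 * (n * B.η * T)) = Real.log ((k / δ) ^ 3) := by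
        rw [Real.log_pow, ← hηsq]; push_cast; ring
      rw [e1, ← Real.log_inv, inv_div]
      refine Real.log_le_log (by positivity) ?_
      rw [div_pow, div_le_div_iff₀ hδ (by positivity)]
      have e2 : δ ^ 3 ≤ δ := pow_le_of_le_one hδ.le hδ1.le (by norm_num)
      have e3 : k + 3 ≤ k ^ 3 := by nlinarith [mul_nonneg (sub_nonneg.2 hmn') (sub_nonneg.2 hmn')]
      exact mul_le_mul e3 e2 (by positivity) (by positivity)
    have hlogk : Real.log k ≤ B.η * (n * B.η * T) := by
      rw [hηsq]
      exact Real.log_le_log hmn0 (by rw [le_div_iff₀ hδ]; nlinarith)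
    refine main _ _ hα hα.le ?_ hlog fun xs hxs hlen hV => ?_
    · refine le_of_eq ?_
      have : k + 3 ≠ 0 := by positivity
      rw [mul_comm (n : ℝ), ← hk]
      field_simp
      ring
    · have hlow : ∀ s, Real.exp s ≤ Real.exp (learnerDev D h l Q B u xs) +
            (∑ a, Real.exp (estimateDev D h l Q B a xs) + Real.exp (massDev B xs)
              + Real.exp (meanDev D h l Q B xs)) → s ≤ B.η * (3 * (n * B.η * T)) := by
        intro s hsle
        refine le_of_mul_exp_lt_one hα hlog (lt_of_le_of_lt ?_ hV)
        rw [potential, ← mul_add]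
        exact mul_le_mul_of_nonneg_left hsle hα.le
      have p1 := Real.exp_pos (learnerDev D h l Q B u xs)
      have p2 := Real.exp_pos (massDev B xs)
      have p3 := Real.exp_pos (meanDev D h l Q B xs)
      have p4 : ∀ a, Real.exp (estimateDev D h l Q B a xs) ≤
          ∑ a, Real.exp (estimateDev D h l Q B a xs) := fun a =>
        Finset.single_le_sum (f := fun a => Real.exp (estimateDev D h l Q B a xs))
          (fun b _ => (Real.exp_pos _).le) (Finset.mem_univ a)
      have p5 : 0 ≤ ∑ a, Real.exp (estimateDev D h l Q B a xs) :=
        Finset.sum_nonneg fun b _ => (Real.exp_pos _).le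
      refine hs.auditor_le hη hlam hρ hρη hsmall hxs ?_ hlogk hmn
        (fun a => hlow _ (by linarith [p4 a])) (hlow _ (by linarith)) (hlow _ (by linarith))
      have : xs.length + 1 = T := by omega
      rw [← this]; push_cast; rfl

end Main

end MDL

theorem mainTheorem3 :
    ∃ C : ℝ, 0 < C ∧
      ∀ (E : Type*) [NormedAddCommGroup E] [NormedSpace ℝ E] [FiniteDimensional ℝ E]
        [MeasurableSpace E] [BorelSpace E] (H : Type*) (Z : Type*) [MeasurableSpace Z]
        (n m T : ℕ) [NeZero n] [NeZero m] (_ : 1 ≤ T)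
        (D : Fin n → Measure Z) [∀ i, IsProbabilityMeasure (D i)]
        (Θ : Set E) (h : E → H) (l : Fin m → H → Z → ℝ)
        (grad : Fin m → E → Z → (E →L[ℝ] ℝ)) (_ : MDL.SmoothConvex Θ h l grad)
        (R : ℝ) (_ : ∀ θ ∈ Θ, ∀ θ' ∈ Θ, ‖θ - θ'‖ ≤ R)
        (Q : MDL.OnlineLearner Θ) (g : ℝ) (_ : Q.HasRegretGuarantee T g)
        (δ : ℝ) (_ : 0 < δ) (_ : δ < 1)
        (ρ : unitInterval) (_ : (ρ : ℝ) ≤ 1 / 2) (_ : (ρ : ℝ) ≤ n * MDL.elpRate n m T δ)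
        (s : stdSimplex ℝ (Fin n × Fin m)) (_ : MDL.IsExploration s),
        let B : MDL.ELP n m := ⟨MDL.elpRate n m T δ, MDL.elpRate n m T δ / 2, ρ, s⟩
        let ε : ℝ :=
          C * √((g + n * Real.log (m * n / δ) + R * Real.log (1 / δ)) / T)
        (MDL.algorithm h l grad Q B T).CallsExactly (2 * (T - 1)) ∧
          ENNReal.ofReal (1 - δ) ≤
            (MDL.algorithm h l grad Q B T).prob D
              {θ | θ ∈ Θ ∧ MDL.IsEpsOptimal D l (h '' Θ) ε (h θ)} := by
  -- Both `√(g / T)` and `n * η` are at most the square root in `ε`, with coefficients 1 and 29.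
  refine ⟨30, by norm_num, ?_⟩
  intro E _ _ _ _ _ H Z _ n m T _ _ hT D _ Θ h l grad hs R hR Q g hg δ hδ hδ1 ρ hρ hρη s _ B ε
  have hn : (1 : ℝ) ≤ n := by exact_mod_cast NeZero.one_le
  have hm : (1 : ℝ) ≤ m := by exact_mod_cast NeZero.one_le
  have hT0 : (0 : ℝ) < T := by exact_mod_cast hT
  have hL : 0 < Real.log (m * n / δ) := by
    refine Real.log_pos ?_
    rw [lt_div_iff₀ hδ]
    nlinarith
  have hη : 0 < B.η := Real.sqrt_pos.2 (by positivity)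
  have hηsq : B.η * (n * B.η * T) = Real.log (m * n / δ) := by
    have : B.η ^ 2 = Real.log (m * n / δ) / (n * T) := Real.sq_sqrt (by positivity)
    rw [eq_div_iff (by positivity)] at this
    linarith
  refine ⟨MDL.callsExactly_rounds h l grad Q B _ (T - 1) _ _,
    hs.prob_algorithm_ge hT hg hδ hδ1 hη hηsq rfl hρ hρη ?_⟩
  have hg0 : 0 ≤ g := hg.1
  have hR0 : 0 ≤ R * Real.log (1 / δ) := by
    obtain ⟨θ, hθ⟩ := hs.nonempty
    refine mul_nonneg (by simpa using hR θ hθ θ hθ) (Real.log_nonneg ?_)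
    rw [le_div_iff₀ hδ]; linarith
  have h1 : √(g / T) ≤ √((g + n * Real.log (m * n / δ) + R * Real.log (1 / δ)) / T) := by
    refine Real.sqrt_le_sqrt ?_
    gcongr
    have : 0 ≤ n * Real.log (m * n / δ) := by positivity
    linarith
  -- Indeed `(n * η) ^ 2 * T = n * log (m * n / δ)`, and the other two summands are nonnegative.
  have h2 : n * B.η ≤ √((g + n * Real.log (m * n / δ) + R * Real.log (1 / δ)) / T) := by
    refine Real.le_sqrt_of_sq_le ?_
    rw [le_div_iff₀ hT0, ← hηsq]
    nlinarith
  linarith
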